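/- **Model.** Let $n\ge 1$, $N=\{0,\dots,n\}$, $N^{\{0,1\}}=\{0,\dots,n-1\}$. Let $\lambda_i>0$ $(0\le i\le n)$, $\mu_0=0$, $\mu_i>0$ $(1\le i\le n)$ and $h_i\in\mathbb R$ $(0\le i\le n)$ be the arrival, service and holding cost rates of a queue with buffer size $n$. Write $\Delta x_i=x_i-x_{i-1}$, $d_i=\mu_i-\lambda_i$, $\rho_i=\lambda_i/\mu_{i+1}$. A stationary policy is a map $u:N\to[0,1]$ with $u(n)=1$, where $u(i)$ is the probability of shutting the entry gate in state $i$; the number in system $L(t)$ is then the birth–death process on $N$ with birth rates $\lambda_i(1-u(i))$ $(i<n)$ and death rates $\mu_i$. For $S\subseteq N^{\{0,1\}}$, the $S$-active policy shuts the gate exactly in $S\cup\{n\}$; a superscript $S$ refers to it. Threshold policies are those with active set in $\mathcal F=\{S_1,\dots,S_{n+1}\}$, where $S_k=\{k-1,\dots,n-1\}$ $(1\le k\le n)$ and $S_{n+1}=\emptyset$. **Average marginal quantities.** Let $\Lambda$ be any number with $\lambda_i+\mu_i\le\Lambda$ for all $i\in N$. Let $\mathbf P^0,\mathbf P^1$ be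 the transition matrices $\mathbf I+\mathbf Q/\Lambda$ of the uniformized chain when the gate is always open and always shut, respectively ($\mathbf Q$ being the generator), with costs $\mathbf h/\Lambda$ per period for both actions, activity weights $\theta_i=\lambda_i/\Lambda$, and discount factor $\beta\in(0,1)$. Let $b_i^S(\beta)$ and $v_i^S(\beta)$ be the expected total discounted activity (the weight $\theta_j$ being counted when the gate is shut in state $j$) and cost from initial state $i$ under the $S$-active policy, and put, for $i\in N$, $$w_i^S(\beta)=\theta_i\,1\{i<n\}+\beta\sum_j(p^1_{ij}-p^0_{ij})\,b_j^S(\beta),\qquad c_i^S(\beta)=\beta\sum_j(p^0_{ij}-p^1_{ij})\,v_j^S(\beta),$$ $$\widehat{\mathbf h}^0(\beta)=\tfrac1\Lambda\left[\mathbf h-(\mathbf I-\beta\mathbf P^0)(\mathbf I-\beta\mathbf P^1)^{-1}\mathbf h\right].$$ The average marginal workloads $\bar w_i^S$, marginal costs $\bar c_i^S$ $(S\in\mathcal F)$ and normalized passive costs $\widehat{\mathbf h}^0$ are the limits of these as $\beta\nearrow1$. **PCL-indexability.** The model is *PCL-indexable under the long-run average criterion* relative to threshold policies and the rejection measure $\bar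 b^u$ if these limits exist and are finite and: (i) $\bar w_j^S>0$ for all $S\in\mathcal F$ and $j\in N^{\{0,1\}}$; (ii) the adaptive-greedy index algorithm on input $\widehat{\mathbf h}^0$ yields nondecreasing indices $\nu_{\pi_1}\le\dots\le\nu_{\pi_n}$. That algorithm starts from $A_1=N^{\{0,1\}}$; at step $k=1,\dots,n$ it chooses $\pi_k$ attaining the minimum $$y_k=\min\Big\{\frac{1}{\bar w_j^{A_k}}\Big[\widehat h_j^0-\sum_{l<k}y_l\,\bar w_j^{A_l}\Big]:\ j\in A_k,\ A_k\setminus\{j\}\in\mathcal F\Big\},$$ and sets $\nu_{\pi_k}=y_1+\dots+y_k$ and $A_{k+1}=A_k\setminus\{\pi_k\}$. An equivalent version of it computes rates $r^{(1)}_j=\widehat h^0_j/\bar w^{A_1}_j$ and $r^{(k)}_j=r^{(k-1)}_j+\big(\bar w^{A_{k-1}}_j/\bar w^{A_k}_j-1\big)\big(r^{(k-1)}_j-r^{(k-1)}_{\pi_{k-1}}\big)$ for $j\in A_k$, chooses $\pi_k$ minimizing $r^{(k)}_j$ over the same $j$, and sets $\nu_{\pi_k}=r^{(k)}_{\pi_k}$;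 (ii) is required of both versions. **Corollary 7.1.** Assume (i) $0\le\Delta d_{i+1}\le\Delta d_i$ for $1\le i\le n-1$, and $\Delta d_1>0$; (ii) $\Delta h_{i+1}\ge\Delta h_i\ge0$ for $1\le i\le n-1$. Then, for every stationary policy $u$, the long-run average rejection rate and holding cost rate $$\bar b^u=\lim_{T\to\infty}\frac1T E^u\Big[\int_0^T\lambda_{L(t)}\,a(t)\,dt\Big],\qquad \bar v^u=\lim_{T\to\infty}\frac1T E^u\Big[\int_0^T h_{L(t)}\,dt\Big]$$ ($a(t)=1$ when the gate is shut, $a(t)=0$ when it is open) exist and do not depend on the initial state. For every $\Lambda$ as above, the model is PCL-indexable under the long-run average criterion relative to threshold policies and $\bar b^u$. The algorithm generates the states in the order $0,1,\dots,n-1$, and the indices $\bar\nu_0\le\dots\le\bar\nu_{n-1}$ it yields are given by the discounted recursions at $\alpha=0$: $$\bar\nu_0=\frac{\Delta h_1}{\Delta d_1},\qquad \bar\nu_j=\bar\nu_{j-1}+\frac{\Delta h_{j+1}-\bar\nu_{j-1}\,\Delta d_{j+1}}{\Delta d_{j+1}+\omega_{j-1}/\rho_{j-1}},\quad 1\le j\le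 n-1,$$ where $\omega_k=\Lambda\,\bar w_k^{S_{k+2}}$ and $\gamma_k=\Lambda\,\bar c_k^{S_{k+2}}$ $(0\le k\le n-1)$ satisfy $\omega_0=\lambda_0\frac{\Delta d_1}{\lambda_0+\mu_1}$, $\gamma_0=\lambda_0\frac{\Delta h_1}{\lambda_0+\mu_1}$ and, for $1\le k\le n-1$, $$\omega_k=\frac{\lambda_k}{a_{k+1}}\,\frac{\Delta d_{k+1}+\omega_{k-1}/\rho_{k-1}}{\lambda_k+\mu_{k+1}},\qquad \gamma_k=\frac{\lambda_k}{a_{k+1}}\,\frac{\Delta h_{k+1}+\gamma_{k-1}/\rho_{k-1}}{\lambda_k+\mu_{k+1}}.$$ Here $a_k=\det(\mathbf I-\mathbf B^k)/\det(\mathbf I-\mathbf B^{k-1})$, and $\mathbf B^k$ is the $k\times k$ tridiagonal matrix with zero diagonal and with entries $\mu_{i-1}/(\lambda_{i-1}+\mu_i)$ to the left and $\lambda_i/(\lambda_{i-1}+\mu_i)$ to the right of the diagonal in row $i$. Moreover, $$\bar\nu_j=\max\Big\{\frac{\bar v^{S\setminus\{j\}}-\bar v^{S}}{\bar b^{S}-\bar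 b^{S\setminus\{j\}}}:\ j\in S\in\{S_1,\dots,S_n\}\Big\},\qquad j\in N^{\{0,1\}},$$ where the quotient stands for the average marginal cost rate $\bar c_j^S/\bar w_j^S$, in the following sense. For all such $j$ and $S$: for $\beta$ close to $1$, $b_j^S(\beta)>b_j^{S\setminus\{j\}}(\beta)$; the discounted quotient $\big(v_j^{S\setminus\{j\}}(\beta)-v_j^S(\beta)\big)/\big(b_j^S(\beta)-b_j^{S\setminus\{j\}}(\beta)\big)$ tends to $\bar c_j^S/\bar w_j^S$ as $\beta\nearrow1$; and $\bar v^{S\setminus\{j\}}-\bar v^S=\frac{\bar c_j^S}{\bar w_j^S}\,(\bar b^S-\bar b^{S\setminus\{j\}})$, so that $\bar c_j^S/\bar w_j^S$ equals the quotient of averages whenever $\bar b^S\ne\bar b^{S\setminus\{j\}}$. The same maximum $\bar\nu_j$ is attained when only the sets $S$ with $\bar b^S\neq\bar b^{S\setminus\{j\}}$ are allowed. -/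

import Mathlib

open Filter Topology Matrix

/-- The backward difference `Δ x_i = x_i - x_{i-1}`; it is only used for `i ≥ 1`. -/
def bdiff (x : ℕ → ℝ) (i : ℕ) : ℝ := x i - x (i - 1)

/-! ### Restless bandits in discrete time -/

/-- The data of a two-action finite-state restless bandit: transition matrices and one-period
costs of the passive action `0` and of the active action `1`, activity weights `θ`, and the set
`ctrl` of controllable states (all other states are uncontrollable). -/
structure BanditData (N : Type*) where
  P0 : Matrix N N ℝ
  P1 : Matrix N N ℝ
  h0 : N → ℝ
  h1 : N → ℝ
  θ : N → ℝ
  ctrl : Finset N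

namespace BanditData

variable {N : Type*} [Fintype N] [DecidableEq N]

/-- The laws of a restless bandit: stochastic transition matrices, positive activity weights, and
no difference between the two actions at uncontrollable states. -/
structure IsRestlessBandit (B : BanditData N) : Prop where
  nonneg0 : ∀ i j, 0 ≤ B.P0 i j
  nonneg1 : ∀ i j, 0 ≤ B.P1 i j
  sum0 : ∀ i, ∑ j, B.P0 i j = 1
  sum1 : ∀ i, ∑ j, B.P1 i j = 1
  weight_pos : ∀ i, 0 < B.θ i
  unctrl_P : ∀ i, i ∉ B.ctrl → ∀ j, B.P0 i j = B.P1 i j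
  unctrl_h : ∀ i, i ∉ B.ctrl → B.h0 i = B.h1 i

/-- The `S`-active policy, as the probability of taking the active action in each state: active on
`S` and on the uncontrollable states, passive on the other controllable states. -/
def activePolicy (B : BanditData N) (S : Finset N) (i : N) : ℝ :=
  if i ∈ S ∨ i ∉ B.ctrl then 1 else 0

/-- Transition matrix under the stationary policy `u`. -/
def policyMatrix (B : BanditData N) (u : N → ℝ) : Matrix N N ℝ :=
  Matrix.of fun i j => u i * B.P1 i j + (1 - u i) * B.P0 i j

/-- Expected total discounted value `E_i^u [∑ t, β ^ t * r (X t)]` of the reward `r` for the chain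
started at `i` under the stationary policy `u`. -/
noncomputable def discounted (B : BanditData N) (β : ℝ) (u r : N → ℝ) (i : N) : ℝ :=
  ∑' t : ℕ, β ^ t * ((B.policyMatrix u ^ t) *ᵥ r) i

/-- Discounted activity measure `b_i^u`. -/
noncomputable def activity (B : BanditData N) (β : ℝ) (u : N → ℝ) (i : N) : ℝ :=
  B.discounted β u (fun j => B.θ j * u j) i

/-- Discounted cost measure `v_i^u`. -/
noncomputable def cost (B : BanditData N) (β : ℝ) (u : N → ℝ) (i : N) : ℝ :=
  B.discounted β u (fun j => u j * B.h1 j + (1 - u j) * B.h0 j) i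

/-- Discounted marginal workload `w_i^S`. -/
noncomputable def marginalWorkload (B : BanditData N) (β : ℝ) (S : Finset N) (i : N) : ℝ :=
  (if i ∈ B.ctrl then B.θ i else 0)
    + β * ∑ j, (B.P1 i j - B.P0 i j) * B.activity β (B.activePolicy S) j

/-- Discounted marginal cost `c_i^S`. -/
noncomputable def marginalCost (B : BanditData N) (β : ℝ) (S : Finset N) (i : N) : ℝ :=
  B.h0 i - B.h1 i + β * ∑ j, (B.P0 i j - B.P1 i j) * B.cost β (B.activePolicy S) j

/-- Increase in discounted cost per unit decrease in discounted activity, when the active set `S` is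
replaced by `S \ {j}` and the initial state is `j`. -/
noncomputable def marginalRate (B : BanditData N) (β : ℝ) (S : Finset N) (j : N) : ℝ :=
  (B.cost β (B.activePolicy (S.erase j)) j - B.cost β (B.activePolicy S) j) /
    (B.activity β (B.activePolicy S) j - B.activity β (B.activePolicy (S.erase j)) j)

/-- Normalized passive-cost vector `h⁰ - (I - β P⁰) (I - β P¹)⁻¹ h¹`. -/
noncomputable def normalizedCost (B : BanditData N) (β : ℝ) : N → ℝ :=
  B.h0 - ((1 - β • B.P0) * (1 - β • B.P1)⁻¹) *ᵥ B.h1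

/-- `w`, `c` and `hhat` are the long-run average marginal workloads, marginal costs and normalized
passive costs, i.e. the (finite) limits of their discounted counterparts as `β ↗ 1`. -/
structure IsAverageLimit (B : BanditData N) (F : Set (Finset N))
    (w c : Finset N → N → ℝ) (hhat : N → ℝ) : Prop where
  workload : ∀ S ∈ F, ∀ i, Tendsto (fun β => B.marginalWorkload β S i) (𝓝[<] 1) (𝓝 (w S i))
  cost : ∀ S ∈ F, ∀ i, Tendsto (fun β => B.marginalCost β S i) (𝓝[<] 1) (𝓝 (c S i))
  input : ∀ i, Tendsto (fun β => B.normalizedCost β i) (𝓝[<] 1) (𝓝 (hhat i))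

end BanditData

/-! ### Set systems, the adaptive-greedy index algorithms and PCL-indexability -/

section SetSystem

variable {N : Type*} [DecidableEq N]

/-- Inner boundary of `S` relative to `F`. -/
def innerBoundary (F : Set (Finset N)) (S : Finset N) : Set N := {j | j ∈ S ∧ S.erase j ∈ F}

/-- Outer boundary of `S` relative to `F`, within the ground set `J`. -/
def outerBoundary (J : Finset N) (F : Set (Finset N)) (S : Finset N) : Set N :=
  {j | j ∈ J ∧ j ∉ S ∧ insert j S ∈ F}

/-- The sets generated by an index algorithm that picks `π 0, π 1, …`: it starts with the ground
set `J`, and the set at step `k + 1` is the one at step `k` without `π k`. -/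
def greedySet (J : Finset N) (π : ℕ → N) : ℕ → Finset N
  | 0 => J
  | k + 1 => (greedySet J π k).erase (π k)

/-- `(π, ν)` is an output of the adaptive-greedy algorithm in its first version on the input cost
vector `c`, relative to the workload coefficients `w`; `y k` is the dual variable of step `k`.
Steps and strings are numbered from `0`, and only `π k` for `k < J.card` matters. -/
def IsAG1Output (J : Finset N) (F : Set (Finset N)) (w : Finset N → N → ℝ) (c : N → ℝ)
    (π : ℕ → N) (ν : N → ℝ) : Prop :=
  ∃ y : ℕ → ℝ, ∀ k < J.card,
    (π k ∈ innerBoundary F (greedySet J π k)) ∧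
    (y k = (c (π k) - ∑ l ∈ Finset.range k, y l * w (greedySet J π l) (π k))
              / w (greedySet J π k) (π k)) ∧
    (∀ j ∈ innerBoundary F (greedySet J π k),
      y k ≤ (c j - ∑ l ∈ Finset.range k, y l * w (greedySet J π l) j)
              / w (greedySet J π k) j) ∧
    (ν (π k) = if k = 0 then y k else ν (π (k - 1)) + y k)

/-- `(π, ν)` is an output of the adaptive-greedy algorithm in its second version; `r k j` is the
marginal cost rate of `j` at step `k`. -/
def IsAG2Output (J : Finset N) (F : Set (Finset N)) (w : Finset N → N → ℝ) (c : N → ℝ)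
    (π : ℕ → N) (ν : N → ℝ) : Prop :=
  ∃ r : ℕ → N → ℝ,
    (∀ j ∈ J, r 0 j = c j / w J j) ∧
    (∀ k, k + 1 < J.card → ∀ j ∈ greedySet J π (k + 1),
      r (k + 1) j = r k j
        + (w (greedySet J π k) j / w (greedySet J π (k + 1)) j - 1) * (r k j - r k (π k))) ∧
    ∀ k < J.card,
      (π k ∈ innerBoundary F (greedySet J π k)) ∧
      (∀ j ∈ innerBoundary F (greedySet J π k), r k (π k) ≤ r k j) ∧
      (ν (π k) = r k (π k))

/-- PCL-indexability relative to the set system `(J, F)`, in terms of the marginal workloads `w`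
and the normalized passive costs `c`: the set system is accessible and augmentable, marginal
workloads are positive, and every output of the index algorithms on input `c` has nondecreasing
indices. The last field says that the algorithms do have an output. -/
structure IsPCLIndexable (J : Finset N) (F : Set (Finset N)) (w : Finset N → N → ℝ)
    (c : N → ℝ) : Prop where
  subset : ∀ S ∈ F, S ⊆ J
  empty_mem : ∅ ∈ F
  accessible : ∀ S ∈ F, S.Nonempty → (innerBoundary F S).Nonempty
  augmentable : ∀ S ∈ F, S ≠ J → (outerBoundary J F S).Nonempty
  workload_pos : ∀ S ∈ F, ∀ j ∈ J, 0 < w S j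
  index_mono : ∀ π ν, IsAG1Output J F w c π ν ∨ IsAG2Output J F w c π ν →
    ∀ k, k + 1 < J.card → ν (π k) ≤ ν (π (k + 1))
  exists_output : ∃ π ν, IsAG1Output J F w c π ν ∧ IsAG2Output J F w c π ν

end SetSystem

/-! ### The admission control model

States `0, …, n` count the customers present; `lam`, `mu` and `h` are the arrival, service and
holding cost rates (only their values at `0, …, n` matter). A stationary policy is given by the
probability `u i` of shutting the entry gate in state `i`, and `u n = 1`. -/

namespace Admission

/-- Stationary policies. -/
def IsPolicy (n : ℕ) (u : Fin (n + 1) → ℝ) : Prop :=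
  (∀ i, 0 ≤ u i ∧ u i ≤ 1) ∧ u (Fin.last n) = 1

/-- The controllable states `0, …, n - 1`. -/
def ctrl (n : ℕ) : Finset (Fin (n + 1)) := Finset.univ.filter fun i => (i : ℕ) < n

/-- The threshold set `S_k = {k - 1, …, n - 1}` for `1 ≤ k ≤ n`, with `S_{n+1} = ∅`. -/
def thresholdSet (n k : ℕ) : Finset (Fin (n + 1)) :=
  Finset.univ.filter fun i => k ≤ (i : ℕ) + 1 ∧ (i : ℕ) < n

/-- The family `{S_1, …, S_{n+1}}` of active sets of threshold policies. -/
def thresholdFamily (n : ℕ) : Set (Finset (Fin (n + 1))) :=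
  {S | ∃ k, 1 ≤ k ∧ k ≤ n + 1 ∧ S = thresholdSet n k}

/-- The `S`-active policy: shut on `S` and in state `n`, open elsewhere. -/
def shutOn (n : ℕ) (S : Finset (Fin (n + 1))) (i : Fin (n + 1)) : ℝ :=
  if i ∈ S ∨ (i : ℕ) = n then 1 else 0

/-- Effective birth rate in state `i` under the policy `u`; no customer enters a full buffer. -/
noncomputable def birthRate (n : ℕ) (lam : ℕ → ℝ) (u : Fin (n + 1) → ℝ) (i : Fin (n + 1)) : ℝ :=
  if (i : ℕ) < n then lam i * (1 - u i) else 0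

/-- Generator of the birth–death process `L(t)` under the policy `u` (with `mu 0 = 0`). -/
noncomputable def generator (n : ℕ) (lam mu : ℕ → ℝ) (u : Fin (n + 1) → ℝ) :
    Matrix (Fin (n + 1)) (Fin (n + 1)) ℝ :=
  Matrix.of fun i j =>
    if (j : ℕ) = i + 1 then birthRate n lam u i
    else if (j : ℕ) + 1 = i then mu i
    else if j = i then -(birthRate n lam u i + mu i)
    else 0

/-- `E_i^u [f (L t)]`: the transition function of the process is `t ↦ exp (t Q)`. -/
noncomputable def expectation (n : ℕ) (lam mu : ℕ → ℝ) (u f : Fin (n + 1) → ℝ)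
    (i : Fin (n + 1)) (t : ℝ) : ℝ :=
  (NormedSpace.exp (t • generator n lam mu u) *ᵥ f) i

/-- `x = lim_{T → ∞} (1 / T) E_i^u [∫_0^T f (L t) dt]` for every initial state `i`. -/
def IsLongRunAverage (n : ℕ) (lam mu : ℕ → ℝ) (u f : Fin (n + 1) → ℝ) (x : ℝ) : Prop :=
  ∀ i, Tendsto (fun T : ℝ => (1 / T) * ∫ t in (0 : ℝ)..T, expectation n lam mu u f i t)
    atTop (𝓝 x)

/-- `x` is the long-run average rejection rate under `u` (in state `i` the arrivals, at rate
`lam i`, are rejected with probability `u i`). -/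
def IsAverageRejection (n : ℕ) (lam mu : ℕ → ℝ) (u : Fin (n + 1) → ℝ) (x : ℝ) : Prop :=
  IsLongRunAverage n lam mu u (fun i => lam i * u i) x

/-- `x` is the long-run average holding cost rate under `u`. -/
def IsAverageCost (n : ℕ) (lam mu h : ℕ → ℝ) (u : Fin (n + 1) → ℝ) (x : ℝ) : Prop :=
  IsLongRunAverage n lam mu u (fun i => h i) x

/-- The discrete-time restless bandit obtained by uniformization at rate `Λ`, for the discount
rate `α`; the action is `0` to open the gate and `1` to shut it. Its discount factor is
`Λ / (α + Λ)`, and the long-run average criterion is the case `α = 0`, studied through discount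
factors that increase to `1`. -/
noncomputable def bandit (n : ℕ) (lam mu h : ℕ → ℝ) (α Λ : ℝ) : BanditData (Fin (n + 1)) where
  P0 := 1 + Λ⁻¹ • generator n lam mu (fun _ => 0)
  P1 := 1 + Λ⁻¹ • generator n lam mu (fun _ => 1)
  h0 := fun i => h i / (α + Λ)
  h1 := fun i => h i / (α + Λ)
  θ := fun i => lam i / (α + Λ)
  ctrl := ctrl n

/-! The recursions for the indices, for a discount rate `α ≥ 0`. -/

/-- The drift `d_i = mu_i - lam_i`. -/
def drift (lam mu : ℕ → ℝ) (i : ℕ) : ℝ := mu i - lam i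

/-- `ρ_i = lam_i / mu_{i+1}`. -/
noncomputable def rho (lam mu : ℕ → ℝ) (i : ℕ) : ℝ := lam i / mu (i + 1)

/-- The tridiagonal `k × k` matrix `B^k`, whose row `i` (from `1` to `k`) has the entries
`mu_{i-1} / (α + lam_{i-1} + mu_i)`, `0` and `lam_i / (α + lam_{i-1} + mu_i)`. Here rows are
numbered from `0`. -/
noncomputable def tridiag (lam mu : ℕ → ℝ) (α : ℝ) (k : ℕ) : Matrix (Fin k) (Fin k) ℝ :=
  Matrix.of fun p q =>
    if (q : ℕ) = p + 1 then lam (p + 1) / (α + lam p + mu (p + 1))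
    else if (q : ℕ) + 1 = p then mu p / (α + lam p + mu (p + 1))
    else 0

/-- `a_k = det (I - B^k) / det (I - B^{k-1})`, for `k ≥ 1`; in particular `a_1 = 1`. -/
noncomputable def aCoeff (lam mu : ℕ → ℝ) (α : ℝ) (k : ℕ) : ℝ :=
  (1 - tridiag lam mu α k).det / (1 - tridiag lam mu α (k - 1)).det

/-- Recursion for the pivot marginal workloads; the value at `k` stands for `w_k^{S_{k+2}}`. -/
noncomputable def pivotWorkload (lam mu : ℕ → ℝ) (α : ℝ) : ℕ → ℝ
  | 0 => lam 0 * ((α + bdiff (drift lam mu) 1) / (α + lam 0 + mu 1))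
  | k + 1 => lam (k + 1) / aCoeff lam mu α (k + 2) *
      ((α + bdiff (drift lam mu) (k + 2) + pivotWorkload lam mu α k / rho lam mu k)
        / (α + lam (k + 1) + mu (k + 2)))

/-- Recursion for the pivot marginal costs; the value at `k` stands for `c_k^{S_{k+2}}`. -/
noncomputable def pivotCost (lam mu h : ℕ → ℝ) (α : ℝ) : ℕ → ℝ
  | 0 => lam 0 / (α + lam 0 + mu 1) * bdiff h 1
  | k + 1 => lam (k + 1) / aCoeff lam mu α (k + 2) *
      ((bdiff h (k + 2) + pivotCost lam mu h α k / rho lam mu k)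
        / (α + lam (k + 1) + mu (k + 2)))

/-- Recursion for the indices `ν_0, …, ν_{n-1}`. -/
noncomputable def indexRec (lam mu h : ℕ → ℝ) (α : ℝ) : ℕ → ℝ
  | 0 => bdiff h 1 / (α + bdiff (drift lam mu) 1)
  | j + 1 => indexRec lam mu h α j +
      (bdiff h (j + 2) - indexRec lam mu h α j * (α + bdiff (drift lam mu) (j + 2)))
        / (α + bdiff (drift lam mu) (j + 2) + pivotWorkload lam mu α j / rho lam mu j)

end Admission

open Admission

/-! Everything reduces to one family of tridiagonal systems. For the uniformized chain, the
increments of a discounted value function, multiplied by `β`, solve a system whose coefficients are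
the death rates, the effective birth rates and the discount rate `Λ (1 - β) / β`. Shutting the gate
in state `i` only removes the jump to `i + 1`, so marginal workloads and costs are `lam i / Λ` times
the `(i + 1)`-st unknown, for right-hand sides built from `Δd` and `Δh`. Gaussian elimination has
positive pivots even at discount rate `0`. Hence the limits as `β ↗ 1` exist and are the solutions
of the limiting system.

Moving the threshold from `m` to `m + 1` changes a single birth rate. By a rank-one update
(`QueueRates.exists_direction`) the solution moves along a direction `g` independent of the
right-hand side, scaled by its own entry `m + 1`. So the cost solution changes by `ν_m` times the
change of the workload solution, where `ν_m` is the marginal cost rate of state `m` at threshold `m`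
(`QueueRates.thrSol_sub`). Since the least state is the only one whose removal keeps a threshold
set, the greedy algorithms have no choice, and this proportionality makes them return `ν_0, ν_1, …`
(`ThresholdLaws`). Forward elimination gives the recursion for `ν_m`, and the convexity of `h` and
concavity of `d` make it nondecreasing (`QueueRates.thrIndex_mono`). The signs of `g` give the
maximum formula (`QueueRates.thrRatio_le`). The elimination pivots are the determinant ratios `a_k`
up to a row scaling (`QueueRates.aCoeff_mul`).

Long-run averages come from the Poisson equation, whose increments solve the same system at discount
rate `0`. Opening the gate at `j` changes both averages by a marginal quantity times the long-run
frequency of `j`, so the frequency cancels in the quotient. If `j` is not the least element of a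
threshold set `S`, state `j` is transient under `S \ {j}` and the quotient of averages degenerates
to `0 / 0`. For the least element the rejection rate changes strictly, so the maximum survives the
restriction to nonzero denominators. -/

/-! ### Tridiagonal systems -/

/-- `x 1, …, x n` solve the tridiagonal system with right-hand side `r` satisfied by the
differences of the value function of a birth–death chain with birth rates `p`, death rates `mu`
and discount rate `α`. -/
def IsTriSol (n : ℕ) (α : ℝ) (mu p r x : ℕ → ℝ) : Prop :=
  ∀ i < n, (α + mu (i + 1) + p i) * x (i + 1) = r (i + 1) + p (i + 1) * x (i + 2) + mu i * x i

/-- Pivots of Gaussian elimination. -/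
noncomputable def triPivot (α : ℝ) (mu p : ℕ → ℝ) : ℕ → ℝ
  | 0 => 1
  | i + 1 => α + mu (i + 1) + p i - mu i * p i / triPivot α mu p i

/-- Right-hand side after forward elimination. -/
noncomputable def triForward (α : ℝ) (mu p r : ℕ → ℝ) : ℕ → ℝ
  | 0 => 0
  | i + 1 => (r (i + 1) + mu i * triForward α mu p r i) / triPivot α mu p (i + 1)

/-- Back substitution, counted from the last unknown. -/
noncomputable def triBack (n : ℕ) (α : ℝ) (mu p r : ℕ → ℝ) : ℕ → ℝ
  | 0 => triForward α mu p r n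
  | k + 1 => triForward α mu p r (n - (k + 1)) +
      p (n - (k + 1)) / triPivot α mu p (n - (k + 1)) * triBack n α mu p r k

/-- The solution of the tridiagonal system. -/
noncomputable def triSol (n : ℕ) (α : ℝ) (mu p r : ℕ → ℝ) (i : ℕ) : ℝ :=
  triBack n α mu p r (n - i)

/-- The sign conditions under which the tridiagonal system is solved. -/
structure TriRates (n : ℕ) (mu p : ℕ → ℝ) : Prop where
  mu_zero : mu 0 = 0
  mu_pos : ∀ i, 1 ≤ i → i ≤ n → 0 < mu i
  p_nonneg : ∀ i, 0 ≤ p i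
  p_last : p n = 0

section Tri

variable {n : ℕ} {α : ℝ} {mu p r x y : ℕ → ℝ}

theorem IsTriSol.lin {r' : ℕ → ℝ} (hx : IsTriSol n α mu p r x) (hy : IsTriSol n α mu p r' y)
    (a b : ℝ) :
    IsTriSol n α mu p (fun i => a * r i + b * r' i) (fun i => a * x i + b * y i) := by
  intro i hi
  linear_combination a * hx i hi + b * hy i hi

theorem triSol_last : triSol n α mu p r n = triForward α mu p r n := by
  simp [triSol, triBack]

theorem triSol_step {i : ℕ} (hi : i < n) :
    triSol n α mu p r i =
      triForward α mu p r i + p i / triPivot α mu p i * triSol n α mu p r (i + 1) := by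
  unfold triSol
  obtain ⟨k, rfl⟩ : ∃ k, n = i + (k + 1) := ⟨n - i - 1, by omega⟩
  have h1 : i + (k + 1) - i = k + 1 := by omega
  have h2 : i + (k + 1) - (i + 1) = k := by omega
  rw [h1, h2, triBack]
  have h3 : i + (k + 1) - (k + 1) = i := by omega
  rw [h3]

theorem triSol_step_of_le (hp : p n = 0) {i : ℕ} (hi : i ≤ n) :
    triSol n α mu p r i =
      triForward α mu p r i + p i / triPivot α mu p i * triSol n α mu p r (i + 1) := by
  rcases hi.lt_or_eq with h | rfl
  · exact triSol_step h
  · rw [triSol_last, hp]; ring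

theorem TriRates.mu_nonneg (H : TriRates n mu p) {i : ℕ} (hi : i ≤ n) : 0 ≤ mu i := by
  rcases Nat.eq_zero_or_pos i with rfl | h
  · exact H.mu_zero.ge
  · exact (H.mu_pos i h hi).le

/-- The induction carries `mu i ≤ triPivot i` because this makes the subtracted term at most `p i`,
leaving at least `α + mu (i + 1)`. No positive discount is needed, which is what allows the passage
to `α = 0`. -/
theorem TriRates.le_triPivot (H : TriRates n mu p) (hα : 0 ≤ α) {i : ℕ} (hi : i ≤ n) :
    mu i ≤ triPivot α mu p i ∧ 0 < triPivot α mu p i := by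
  induction i with
  | zero => simp [triPivot, H.mu_zero]
  | succ i ih =>
    obtain ⟨h1, h2⟩ := ih (by omega)
    have h3 : mu i * p i / triPivot α mu p i ≤ p i := by
      rw [div_le_iff₀ h2]
      nlinarith [H.p_nonneg i]
    have h4 := H.mu_pos (i + 1) (by omega) hi
    simp only [triPivot]
    constructor <;> linarith

theorem TriRates.triPivot_pos (H : TriRates n mu p) (hα : 0 ≤ α) {i : ℕ} (hi : i ≤ n) :
    0 < triPivot α mu p i := (H.le_triPivot hα hi).2

theorem TriRates.lt_triPivot (H : TriRates n mu p) (hα : 0 ≤ α) {m : ℕ} (hm : m ≤ n)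
    (hp : ∀ i < m, 0 < p i) {i : ℕ} (hi : i ≤ m) : mu i < triPivot α mu p i := by
  induction i with
  | zero => simp [triPivot, H.mu_zero]
  | succ i ih =>
    have h1 := ih (by omega)
    have h2 := H.triPivot_pos hα (show i ≤ n by omega)
    have h3 : mu i * p i / triPivot α mu p i < p i := by
      rw [div_lt_iff₀ h2]
      nlinarith [hp i (by omega)]
    simp only [triPivot]
    linarith

/-- A sequence solves the system if and only if it satisfies the eliminated equations. -/
theorem TriRates.isTriSol_iff (H : TriRates n mu p) (hα : 0 ≤ α) :
    IsTriSol n α mu p r x ↔ ∀ i, 1 ≤ i → i ≤ n →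
      x i = triForward α mu p r i + p i / triPivot α mu p i * x (i + 1) := by
  have key : ∀ i < n, (1 ≤ i → x i = triForward α mu p r i + p i / triPivot α mu p i * x (i + 1)) →
      ((α + mu (i + 1) + p i) * x (i + 1) = r (i + 1) + p (i + 1) * x (i + 2) + mu i * x i ↔
        x (i + 1) = triForward α mu p r (i + 1)
          + p (i + 1) / triPivot α mu p (i + 1) * x (i + 2)) := by
    intro i hi h
    have hE := H.triPivot_pos hα (show i ≤ n by omega)
    have hE1 := H.triPivot_pos hα (show i + 1 ≤ n by omega)
    -- For `i = 0` there is no eliminated equation to substitute; `mu 0 = 0` removes the term, so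
    -- the initial values of the pivots and of the forward pass are harmless.
    have hmx : mu i * x i = mu i * triForward α mu p r i
        + mu i * p i / triPivot α mu p i * x (i + 1) := by
      rcases Nat.eq_zero_or_pos i with rfl | h0
      · simp [H.mu_zero]
      · rw [h h0]; ring
    have hdef : triPivot α mu p (i + 1) = α + mu (i + 1) + p i - mu i * p i / triPivot α mu p i :=
      rfl
    have hz : triForward α mu p r (i + 1)
        = (r (i + 1) + mu i * triForward α mu p r i) / triPivot α mu p (i + 1) := rfl
    rw [hmx, hz, div_mul_eq_mul_div (p (i + 1)), ← add_div, eq_div_iff hE1.ne', hdef]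
    constructor <;> intro h' <;> linear_combination h'
  constructor
  · intro hx i h1 hi
    induction i with
    | zero => omega
    | succ i ih =>
      exact (key i (by omega) fun h => ih h (by omega)).1 (hx i (by omega))
  · intro hx i hi
    exact (key i hi fun h => hx i h (by omega)).2 (hx (i + 1) (by omega) (by omega))

theorem TriRates.isTriSol_triSol (H : TriRates n mu p) (hα : 0 ≤ α) :
    IsTriSol n α mu p r (triSol n α mu p r) :=
  (H.isTriSol_iff hα).2 fun _ _ hi => triSol_step_of_le H.p_last hi

theorem TriRates.eq_triSol (H : TriRates n mu p) (hα : 0 ≤ α) (hx : IsTriSol n α mu p r x)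
    {i : ℕ} (h1 : 1 ≤ i) (hi : i ≤ n) : x i = triSol n α mu p r i := by
  have hx' := (H.isTriSol_iff hα).1 hx
  induction hi using Nat.decreasingInduction with
  | self => rw [hx' n h1 le_rfl, triSol_last, H.p_last]; ring
  | of_succ k hk ih => rw [hx' k h1 hk.le, triSol_step hk, ih (by omega)]

theorem TriRates.triForward_pos (H : TriRates n mu p) (hα : 0 ≤ α) (hr1 : 0 < r 1)
    (hr : ∀ i, 1 ≤ i → i ≤ n → 0 ≤ r i) {i : ℕ} (h1 : 1 ≤ i) (hi : i ≤ n) :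
    0 < triForward α mu p r i := by
  induction i with
  | zero => omega
  | succ i ih =>
    refine div_pos ?_ (H.triPivot_pos hα hi)
    rcases Nat.eq_zero_or_pos i with rfl | h0
    · simpa [H.mu_zero] using hr1
    · exact add_pos_of_nonneg_of_pos (hr _ h1 hi)
        (mul_pos (H.mu_pos i h0 (by omega)) (ih h0 (by omega)))

theorem TriRates.triSol_pos (H : TriRates n mu p) (hα : 0 ≤ α) (hr1 : 0 < r 1)
    (hr : ∀ i, 1 ≤ i → i ≤ n → 0 ≤ r i) {i : ℕ} (h1 : 1 ≤ i) (hi : i ≤ n) :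
    0 < triSol n α mu p r i := by
  induction hi using Nat.decreasingInduction with
  | self => rw [triSol_last]; exact H.triForward_pos hα hr1 hr h1 le_rfl
  | of_succ k hk ih =>
    rw [triSol_step hk]
    exact add_pos_of_pos_of_nonneg (H.triForward_pos hα hr1 hr h1 hk.le)
      (mul_nonneg (div_nonneg (H.p_nonneg k) (H.triPivot_pos hα hk.le).le) (ih (by omega)).le)

/-- Elimination only divides by pivots, and these stay away from zero at the limit rate `0`. -/
theorem TriRates.tendsto_triSol (H : TriRates n mu p) {ι : Type*} {l : Filter ι} {a : ι → ℝ}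
    {R : ι → ℕ → ℝ} (ha : Tendsto a l (𝓝 0))
    (hR : ∀ i, 1 ≤ i → i ≤ n → Tendsto (fun t => R t i) l (𝓝 (r i))) {i : ℕ} (hi : i ≤ n) :
    Tendsto (fun t => triSol n (a t) mu p (R t) i) l (𝓝 (triSol n 0 mu p r i)) := by
  have hE : ∀ i ≤ n, Tendsto (fun t => triPivot (a t) mu p i) l (𝓝 (triPivot 0 mu p i)) := by
    intro i hi
    induction i with
    | zero => exact tendsto_const_nhds
    | succ i ih =>
      exact ((ha.add tendsto_const_nhds).add tendsto_const_nhds).sub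
        (tendsto_const_nhds.div (ih (by omega)) (H.triPivot_pos le_rfl (by omega)).ne')
  have hz : ∀ i ≤ n, Tendsto (fun t => triForward (a t) mu p (R t) i) l
      (𝓝 (triForward 0 mu p r i)) := by
    intro i hi
    induction i with
    | zero => exact tendsto_const_nhds
    | succ i ih =>
      exact ((hR _ (by omega) hi).add (tendsto_const_nhds.mul (ih (by omega)))).div (hE _ hi)
        (H.triPivot_pos le_rfl hi).ne'
  induction hi using Nat.decreasingInduction with
  | self => simp only [triSol_last]; exact hz n le_rfl
  | of_succ k hk ih =>
    simp only [triSol_step hk]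
    exact (hz k hk.le).add ((tendsto_const_nhds.div (hE k hk.le)
      (H.triPivot_pos le_rfl hk.le).ne').mul ih)

end Tri

/-! ### Threshold birth rates -/

/-- Birth rates of the chain whose gate is open exactly below the threshold `m`. -/
noncomputable def thrRate (lam : ℕ → ℝ) (m i : ℕ) : ℝ := if i < m then lam i else 0

/-- Solution of the tridiagonal system at discount rate `0` for the threshold `m`. -/
noncomputable def thrSol (n : ℕ) (lam mu : ℕ → ℝ) (m : ℕ) (r : ℕ → ℝ) : ℕ → ℝ :=
  triSol n 0 mu (thrRate lam m) r

/-- Positivity of the arrival and service rates. -/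
structure QueueRates (n : ℕ) (lam mu : ℕ → ℝ) : Prop where
  lam_pos : ∀ i, i ≤ n → 0 < lam i
  mu_zero : mu 0 = 0
  mu_pos : ∀ i, 1 ≤ i → i ≤ n → 0 < mu i

/-! ### Response of the solution to a shift of the threshold -/

section Thr

variable {n m : ℕ} {lam mu r s : ℕ → ℝ}

theorem QueueRates.triRates (Q : QueueRates n lam mu) (hm : m ≤ n) :
    TriRates n mu (thrRate lam m) where
  mu_zero := Q.mu_zero
  mu_pos := Q.mu_pos
  p_nonneg i := by
    unfold thrRate
    split_ifs
    · exact (Q.lam_pos i (by omega)).le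
    · exact le_rfl
  p_last := if_neg (by omega)

theorem triPivot_thrRate {α : ℝ} {i : ℕ} (hi : i ≤ m) :
    triPivot α mu (thrRate lam m) i = triPivot α mu lam i := by
  induction i with
  | zero => rfl
  | succ i ih =>
    have h : thrRate lam m i = lam i := if_pos (by omega)
    simp only [triPivot, ih (by omega), h]

theorem triForward_thrRate {α : ℝ} {i : ℕ} (hi : i ≤ m) :
    triForward α mu (thrRate lam m) r i = triForward α mu lam r i := by
  induction i with
  | zero => rfl
  | succ i ih => simp only [triForward, ih (by omega), triPivot_thrRate hi]

theorem QueueRates.thrSol_of_ge (Q : QueueRates n lam mu) (hm : m ≤ n) {i : ℕ} (hmi : m ≤ i)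
    (hi : i ≤ n) : thrSol n lam mu m r i = triForward 0 mu (thrRate lam m) r i := by
  have h : thrRate lam m i = 0 := if_neg (by omega)
  rw [thrSol, triSol_step_of_le (Q.triRates hm).p_last hi, h]
  ring

/-- The gate is shut in state `m`, so back substitution contributes nothing there, and the
elimination up to row `m` only sees the original rates `lam`. The pivot quantities are therefore
pure forward recursions. -/
theorem QueueRates.thrSol_self (Q : QueueRates n lam mu) (hm : m ≤ n) :
    thrSol n lam mu m r m = triForward 0 mu lam r m := by
  rw [Q.thrSol_of_ge hm le_rfl hm, triForward_thrRate le_rfl]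

theorem QueueRates.thrSol_succ (Q : QueueRates n lam mu) (hm : m + 1 ≤ n) :
    mu (m + 1) * thrSol n lam mu m r (m + 1) = r (m + 1) + mu m * triForward 0 mu lam r m := by
  have h := (Q.triRates (show m ≤ n by omega)).isTriSol_triSol (r := r) le_rfl m (by omega)
  have h1 : thrRate lam m m = 0 := if_neg (by omega)
  have h2 : thrRate lam m (m + 1) = 0 := if_neg (by omega)
  rw [← Q.thrSol_self (show m ≤ n by omega)]
  rw [h1, h2] at h
  unfold thrSol
  linear_combination h

/-- Raising the threshold from `m` to `m + 1` changes the solution, for every right-hand side, in a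
direction `g` that does not depend on the right-hand side. -/
theorem QueueRates.exists_direction (Q : QueueRates n lam mu) (hm : m + 1 ≤ n) :
    ∃ g : ℕ → ℝ, (∀ i, m + 1 ≤ i → i ≤ n → g i ≤ 0) ∧ (∀ i, 1 ≤ i → i ≤ m → 0 < g i) ∧
      ∀ r i, 1 ≤ i → i ≤ n →
        thrSol n lam mu (m + 1) r i
          = thrSol n lam mu m r i + thrSol n lam mu m r (m + 1) * g i := by
  have hmn : m ≤ n := by omega
  have T := Q.triRates hmn
  have T' := Q.triRates hm
  set e : ℕ → ℝ := fun i => if i = m then 1 else if i = m + 1 then -1 else 0 with he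
  set p := thrRate lam m with hp
  set G := triSol n 0 mu p e with hG
  have hpos : ∀ i < m, 0 < p i := fun i hi => by
    rw [hp, thrRate, if_pos hi]; exact Q.lam_pos i (by omega)
  have hz0 : ∀ i < m, triForward 0 mu p e i = 0 := by
    intro i hi
    induction i with
    | zero => rfl
    | succ i ih =>
      have : e (i + 1) = 0 := by simp only [he]; rw [if_neg (by omega), if_neg (by omega)]
      rw [triForward, ih (by omega), this]; simp
  -- The strict bound `mu m < triPivot m` says that less than one unit of the perturbation in row
  -- `m` is carried on to row `m + 1`, where it meets `-1`. This fixes the sign of `G` from `m + 1`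
  -- on.
  have hzm : mu m * triForward 0 mu p e m < 1 ∧ (1 ≤ m → 0 < triForward 0 mu p e m) := by
    rcases Nat.eq_zero_or_pos m with h0 | h0
    · rw [h0]; simp [triForward]
    · obtain ⟨k, rfl⟩ : ∃ k, m = k + 1 := ⟨m - 1, by omega⟩
      have h1 : e (k + 1) = 1 := by simp [he]
      have h2 := T.triPivot_pos le_rfl hmn
      rw [triForward, hz0 k (by omega), h1, mul_zero, add_zero, mul_one_div, div_lt_one h2]
      exact ⟨T.lt_triPivot le_rfl hmn hpos le_rfl, fun _ => by positivity⟩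
  have hzge : ∀ i, m + 1 ≤ i → i ≤ n → triForward 0 mu p e i ≤ 0 := by
    intro i h1 h2
    induction i, h1 using Nat.le_induction with
    | base =>
      have : e (m + 1) = -1 := by simp [he]
      rw [triForward, this]
      exact div_nonpos_of_nonpos_of_nonneg (by linarith [hzm.1]) (T.triPivot_pos le_rfl h2).le
    | succ i h1 ih =>
      have : e (i + 1) = 0 := by simp only [he]; rw [if_neg (by omega), if_neg (by omega)]
      rw [triForward, this, zero_add]
      exact div_nonpos_of_nonpos_of_nonneg
        (mul_nonpos_of_nonneg_of_nonpos (T.mu_nonneg (by omega)) (ih (by omega)))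
        (T.triPivot_pos le_rfl h2).le
  have hGge : ∀ i, m ≤ i → i ≤ n → G i = triForward 0 mu p e i := fun i h1 h2 =>
    Q.thrSol_of_ge hmn h1 h2
  have hGneg : ∀ i, m + 1 ≤ i → i ≤ n → G i ≤ 0 := fun i h1 h2 => by
    rw [hGge i (by omega) h2]; exact hzge i h1 h2
  have hGpos : ∀ i, 1 ≤ i → i ≤ m → 0 < G i := by
    intro i h1 h2
    induction h2 using Nat.decreasingInduction with
    | self => rw [hGge m le_rfl hmn]; exact hzm.2 h1
    | of_succ k hk ih =>
      rw [hG, triSol_step (by omega), hz0 k hk, zero_add]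
      exact mul_pos (div_pos (hpos k hk) (T.triPivot_pos le_rfl (by omega))) (ih (by omega))
  have hD : 0 < 1 - lam m * G (m + 1) := by
    nlinarith [hGneg (m + 1) le_rfl hm, Q.lam_pos m hmn]
  have hlm := Q.lam_pos m hmn
  refine ⟨fun i => lam m * G i / (1 - lam m * G (m + 1)), fun i h1 h2 => ?_, fun i h1 h2 => ?_,
    fun r i h1 h2 => ?_⟩
  · exact div_nonpos_of_nonpos_of_nonneg
      (mul_nonpos_of_nonneg_of_nonpos hlm.le (hGneg i h1 h2)) hD.le
  · exact div_pos (mul_pos hlm (hGpos i h1 h2)) hD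
  · set X := thrSol n lam mu m r with hX
    set X' := thrSol n lam mu (m + 1) r with hX'
    -- The new solution `X'` solves the old system with a perturbed right-hand side. Reading the
    -- resulting identity at `m + 1` expresses the implicit factor `X' (m + 1)` through `X (m + 1)`.
    have hsol : IsTriSol n 0 mu p (fun i => 1 * r i + lam m * X' (m + 1) * e i) X' := by
      intro i hi
      have h := T'.isTriSol_triSol (r := r) le_rfl i hi
      change (0 + mu (i + 1) + thrRate lam (m + 1) i) * X' (i + 1)
        = r (i + 1) + thrRate lam (m + 1) (i + 1) * X' (i + 2) + mu i * X' i at h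
      simp only [he, hp]
      simp only [thrRate] at h ⊢
      rcases lt_trichotomy (i + 1) m with h3 | h3 | h3
      · simp (disch := omega) only [if_pos, if_neg] at h ⊢
        linear_combination h
      · subst h3
        simp (disch := omega) only [if_pos, if_neg, ↓reduceIte] at h ⊢
        linear_combination h
      · rcases Nat.eq_or_lt_of_le (show m ≤ i by omega) with h4 | h4
        · subst h4
          simp (disch := omega) only [if_pos, if_neg, ↓reduceIte] at h ⊢
          linear_combination h
        · simp (disch := omega) only [if_neg] at h ⊢
          linear_combination h
    have hsol' : IsTriSol n 0 mu p (fun i => 1 * r i + lam m * X' (m + 1) * e i)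
        (fun i => 1 * X i + lam m * X' (m + 1) * G i) :=
      (T.isTriSol_triSol le_rfl).lin (T.isTriSol_triSol le_rfl) _ _
    have heq : ∀ i, 1 ≤ i → i ≤ n → X' i = X i + lam m * X' (m + 1) * G i := by
      intro i h1 h2
      rw [T.eq_triSol le_rfl hsol h1 h2, ← T.eq_triSol le_rfl hsol' h1 h2, one_mul]
    have hm1 : X' (m + 1) * (1 - lam m * G (m + 1)) = X (m + 1) := by
      linear_combination heq (m + 1) (by omega) hm
    rw [heq i h1 h2, ← hm1]
    field_simp

/-! ### Monotonicity and extremality of the indices -/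

/-- Data for which the right-hand sides satisfy the regularity conditions on drifts and costs. -/
structure RegularRhs (n : ℕ) (r s : ℕ → ℝ) : Prop where
  drift_pos : 0 < r 1
  drift : ∀ i, 1 ≤ i → i + 1 ≤ n → 0 ≤ r (i + 1) ∧ r (i + 1) ≤ r i
  cost : ∀ i, 1 ≤ i → i + 1 ≤ n → s i ≤ s (i + 1) ∧ 0 ≤ s i

theorem RegularRhs.drift_nonneg (R : RegularRhs n r s) {i : ℕ} (h1 : 1 ≤ i) (hi : i ≤ n) :
    0 ≤ r i := by
  obtain ⟨k, rfl⟩ : ∃ k, i = k + 1 := ⟨i - 1, by omega⟩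
  rcases Nat.eq_zero_or_pos k with rfl | h0
  · exact R.drift_pos.le
  · exact (R.drift k h0 hi).1

theorem QueueRates.thrSol_pos (Q : QueueRates n lam mu) (R : RegularRhs n r s) (hm : m ≤ n)
    {i : ℕ} (h1 : 1 ≤ i) (hi : i ≤ n) : 0 < thrSol n lam mu m r i :=
  (Q.triRates hm).triSol_pos le_rfl R.drift_pos (fun _ h1 h2 => R.drift_nonneg h1 h2) h1 hi

/-- The marginal cost rate of state `m` under the threshold `m`. -/
noncomputable def thrIndex (n : ℕ) (lam mu r s : ℕ → ℝ) (m : ℕ) : ℝ :=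
  thrSol n lam mu m s (m + 1) / thrSol n lam mu m r (m + 1)

theorem QueueRates.thrSol_sub (Q : QueueRates n lam mu) (R : RegularRhs n r s) (hm : m + 1 ≤ n)
    {i : ℕ} (h1 : 1 ≤ i) (hi : i ≤ n) :
    thrSol n lam mu (m + 1) s i - thrSol n lam mu m s i = thrIndex n lam mu r s m *
      (thrSol n lam mu (m + 1) r i - thrSol n lam mu m r i) := by
  obtain ⟨g, -, -, hg⟩ := Q.exists_direction hm
  have h0 := (Q.thrSol_pos R (show m ≤ n by omega) (show 1 ≤ m + 1 by omega) hm).ne'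
  rw [hg s i h1 hi, hg r i h1 hi, thrIndex]
  field_simp
  ring

theorem QueueRates.thrSol_anti (Q : QueueRates n lam mu) (R : RegularRhs n r s) (hm : m + 1 ≤ n)
    {i : ℕ} (h1 : m + 1 ≤ i) (hi : i ≤ n) :
    thrSol n lam mu (m + 1) r i ≤ thrSol n lam mu m r i := by
  obtain ⟨g, hneg, -, hg⟩ := Q.exists_direction hm
  have h0 := Q.thrSol_pos R (show m ≤ n by omega) (show 1 ≤ m + 1 by omega) hm
  rw [hg r i (by omega) hi]
  nlinarith [hneg i h1 hi]

theorem QueueRates.thrSol_one_lt (Q : QueueRates n lam mu) (R : RegularRhs n r s)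
    (hm : m + 1 ≤ n) (h1 : 1 ≤ m) : thrSol n lam mu m r 1 < thrSol n lam mu (m + 1) r 1 := by
  obtain ⟨g, -, hpos, hg⟩ := Q.exists_direction hm
  have h0 := Q.thrSol_pos R (show m ≤ n by omega) (show 1 ≤ m + 1 by omega) hm
  rw [hg r 1 le_rfl (by omega)]
  nlinarith [mul_pos h0 (hpos 1 le_rfl h1)]

/-- The entries `m + 1` at threshold `m` have ratio `thrIndex m`, and so do their changes; hence
state `m` keeps the same marginal cost rate after the threshold has passed it. -/
theorem QueueRates.triForward_eq_thrIndex_mul (Q : QueueRates n lam mu) (R : RegularRhs n r s)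
    (hm : m + 1 ≤ n) :
    triForward 0 mu lam s (m + 1) = thrIndex n lam mu r s m * triForward 0 mu lam r (m + 1) := by
  have h := Q.thrSol_sub R hm (show 1 ≤ m + 1 by omega) hm
  have h0 := (Q.thrSol_pos R (show m ≤ n by omega) (show 1 ≤ m + 1 by omega) hm).ne'
  rw [Q.thrSol_self hm, Q.thrSol_self hm] at h
  have h2 : thrIndex n lam mu r s m * thrSol n lam mu m r (m + 1) = thrSol n lam mu m s (m + 1) :=
    div_mul_cancel₀ _ h0
  linear_combination h - h2

/-- With the gate shut in `m`, row `m + 1` involves only the forward pass. Combined with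
`QueueRates.triForward_eq_thrIndex_mul` for the preceding state, this is the recursion of the
indices. -/
theorem QueueRates.thrIndex_mul (Q : QueueRates n lam mu) (R : RegularRhs n r s)
    (hm : m + 1 ≤ n) :
    thrIndex n lam mu r s m * (r (m + 1) + mu m * triForward 0 mu lam r m)
      = s (m + 1) + mu m * triForward 0 mu lam s m := by
  have h0 := (Q.thrSol_pos R (show m ≤ n by omega) (show 1 ≤ m + 1 by omega) hm).ne'
  have h2 : thrIndex n lam mu r s m * thrSol n lam mu m r (m + 1) = thrSol n lam mu m s (m + 1) :=
    div_mul_cancel₀ _ h0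
  rw [← Q.thrSol_succ hm, ← Q.thrSol_succ hm]
  linear_combination mu (m + 1) * h2

theorem QueueRates.triForward_lam_pos (Q : QueueRates n lam mu) (R : RegularRhs n r s)
    (h1 : 1 ≤ m) (hm : m ≤ n) : 0 < triForward 0 mu lam r m := by
  rw [← Q.thrSol_self hm]; exact Q.thrSol_pos R hm h1 hm

theorem QueueRates.thrIndex_mono (Q : QueueRates n lam mu) (R : RegularRhs n r s)
    (hm : m + 2 ≤ n) :
    thrIndex n lam mu r s m ≤ thrIndex n lam mu r s (m + 1) := by
  -- With `q > 0` as below, the recursion reads `b (r (m + 2) + q) = s (m + 2) + q a`. The invariant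
  -- `a r (m + 1) ≤ s (m + 1)` gives `a r (m + 2) ≤ s (m + 2)`, since `a ≥ 0`, `r` decreases and `s`
  -- increases. Then `a ≤ b`, and `b r (m + 2) = s (m + 2) - q (b - a)` restores the invariant.
  have step : ∀ m, m + 2 ≤ n → 0 ≤ thrIndex n lam mu r s m →
      thrIndex n lam mu r s m * r (m + 1) ≤ s (m + 1) →
      thrIndex n lam mu r s m ≤ thrIndex n lam mu r s (m + 1) ∧
        thrIndex n lam mu r s (m + 1) * r (m + 2) ≤ s (m + 2) := by
    intro m hm h0 hle
    have hZ := Q.triForward_lam_pos R (show 1 ≤ m + 1 by omega) (by omega)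
    have hmu := Q.mu_pos (m + 1) (by omega) (by omega)
    have heq := Q.thrIndex_mul R (m := m + 1) (by omega)
    rw [Q.triForward_eq_thrIndex_mul R (by omega)] at heq
    have hd := R.drift (m + 1) (by omega) (by omega)
    have hc := R.cost (m + 1) (by omega) (by omega)
    set a := thrIndex n lam mu r s m
    set b := thrIndex n lam mu r s (m + 1)
    set q := mu (m + 1) * triForward 0 mu lam r (m + 1) with hq
    have hqpos : 0 < q := mul_pos hmu hZ
    have e1 : b * (r (m + 2) + q) = s (m + 2) + q * a := by
      rw [hq]; linear_combination heq
    have e2 : a * r (m + 2) ≤ s (m + 2) :=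
      (mul_le_mul_of_nonneg_left hd.2 h0).trans (hle.trans hc.1)
    have hab : a ≤ b := by
      have : a * (r (m + 2) + q) ≤ b * (r (m + 2) + q) := by linarith
      exact le_of_mul_le_mul_right this (by linarith [hd.1])
    exact ⟨hab, by nlinarith⟩
  have base : thrIndex n lam mu r s 0 * r 1 = s 1 := by
    have := Q.thrIndex_mul R (m := 0) (by omega)
    simpa [Q.mu_zero] using this
  have all : ∀ m, m + 2 ≤ n → 0 ≤ thrIndex n lam mu r s m ∧
      thrIndex n lam mu r s m * r (m + 1) ≤ s (m + 1) := by
    intro m hm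
    induction m with
    | zero =>
      refine ⟨?_, base.le⟩
      have := (R.cost 1 le_rfl hm).2
      rw [← base] at this
      exact nonneg_of_mul_nonneg_left this R.drift_pos
    | succ m ih =>
      obtain ⟨h1, h2⟩ := ih (by omega)
      obtain ⟨h3, h4⟩ := step m (by omega) h1 h2
      exact ⟨h1.trans h3, h4⟩
  exact (step m hm (all m hm).1 (all m hm).2).1

/-- Marginal cost rate of state `j` under the threshold `m`. -/
noncomputable def thrRatio (n : ℕ) (lam mu r s : ℕ → ℝ) (m j : ℕ) : ℝ :=
  thrSol n lam mu m s (j + 1) / thrSol n lam mu m r (j + 1)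

theorem QueueRates.thrRatio_succ (Q : QueueRates n lam mu) (R : RegularRhs n r s)
    (hm : m + 1 ≤ n) {j : ℕ} (hj : j + 1 ≤ n) :
    thrRatio n lam mu r s (m + 1) j - thrIndex n lam mu r s m =
      thrSol n lam mu m r (j + 1) / thrSol n lam mu (m + 1) r (j + 1) *
        (thrRatio n lam mu r s m j - thrIndex n lam mu r s m) := by
  have h := Q.thrSol_sub R hm (show 1 ≤ j + 1 by omega) hj
  have h0 := (Q.thrSol_pos R (show m ≤ n by omega) (show 1 ≤ j + 1 by omega) hj).ne'
  have h1 := (Q.thrSol_pos R hm (show 1 ≤ j + 1 by omega) hj).ne'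
  unfold thrRatio
  field_simp
  linear_combination h

/-- By `QueueRates.thrRatio_succ`, lowering the threshold by one divides the gap between the rate of
`j` and `thrIndex k` by a factor that is at least `1`. The gap is nonnegative because the indices
increase, so the rate can only drop. The descending induction from `m = j` therefore carries the
lower bound `thrIndex m` as well. -/
theorem QueueRates.thrRatio_le (Q : QueueRates n lam mu) (R : RegularRhs n r s) {j : ℕ}
    (hj : j + 1 ≤ n) (hm : m ≤ j) :
    thrRatio n lam mu r s m j ≤ thrIndex n lam mu r s j := by
  have key : thrIndex n lam mu r s m ≤ thrRatio n lam mu r s m j ∧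
      thrRatio n lam mu r s m j ≤ thrIndex n lam mu r s j := by
    induction hm using Nat.decreasingInduction with
    | self => exact ⟨le_rfl, le_rfl⟩
    | of_succ k hk ih =>
      have h := Q.thrRatio_succ R (show k + 1 ≤ n by omega) hj
      have hpos := Q.thrSol_pos R (show k + 1 ≤ n by omega) (show 1 ≤ j + 1 by omega) hj
      have hge : 1 ≤ thrSol n lam mu k r (j + 1) / thrSol n lam mu (k + 1) r (j + 1) := by
        rw [le_div_iff₀ hpos, one_mul]
        exact Q.thrSol_anti R (by omega) (by omega) hj
      have hmono := Q.thrIndex_mono R (m := k) (by omega)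
      have hnn : 0 ≤ thrRatio n lam mu r s k j - thrIndex n lam mu r s k := by
        refine nonneg_of_mul_nonneg_right
          (a := thrSol n lam mu k r (j + 1) / thrSol n lam mu (k + 1) r (j + 1)) ?_ (by linarith)
        rw [← h]; linarith [ih.1]
      refine ⟨by linarith, ?_⟩
      nlinarith [ih.2]
  exact key.2

end Thr

/-! ### Determinants of tridiagonal matrices -/

/-- Laplace expansion along the last row, then along the last column of the off-diagonal minor: the
three-term recursion of continuants. -/
theorem det_tridiagonal_succ {A : ℕ → ℕ → ℝ} (hA : ∀ p q, p + 1 < q ∨ q + 1 < p → A p q = 0)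
    (k : ℕ) :
    (Matrix.of fun p q : Fin (k + 2) => A p q).det =
      A (k + 1) (k + 1) * (Matrix.of fun p q : Fin (k + 1) => A p q).det -
        A (k + 1) k * A k (k + 1) * (Matrix.of fun p q : Fin k => A p q).det := by
  have h1 : ((Matrix.of fun p q : Fin (k + 2) => A p q).submatrix (Fin.last (k + 1)).succAbove
      (Fin.last (k + 1)).succAbove) = Matrix.of fun p q : Fin (k + 1) => A p q := by
    ext p q; simp
  have h2 : ((Matrix.of fun p q : Fin (k + 2) => A p q).submatrix (Fin.last (k + 1)).succAbove
      (Fin.last k).castSucc.succAbove).det =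
        A k (k + 1) * (Matrix.of fun p q : Fin k => A p q).det := by
    rw [Matrix.det_succ_column _ (Fin.last k), Fin.sum_univ_castSucc, Finset.sum_eq_zero, zero_add]
    · have h3 : (((Matrix.of fun p q : Fin (k + 2) => A p q).submatrix
          (Fin.last (k + 1)).succAbove (Fin.last k).castSucc.succAbove).submatrix
          (Fin.last k).succAbove (Fin.last k).succAbove) = Matrix.of fun p q : Fin k => A p q := by
        ext p q
        simp [Fin.succAbove, Fin.lt_def]
      rw [h3]
      have h4 : (Fin.last k).castSucc.succAbove (Fin.last k) = Fin.last (k + 1) := by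
        simp [Fin.succAbove]
      simp [h4, ← two_mul]
    · intro p _
      have h4 : (Fin.last k).castSucc.succAbove (Fin.last k) = Fin.last (k + 1) := by
        simp [Fin.succAbove]
      have := hA p (k + 1) (by have := p.2; omega)
      simp [h4, this]
  rw [Matrix.det_succ_row _ (Fin.last (k + 1)), Fin.sum_univ_castSucc, Fin.sum_univ_castSucc,
    Finset.sum_eq_zero, zero_add, h1, h2]
  · have e1 : (-1 : ℝ) ^ (k + 1 + k) = -1 := Odd.neg_one_pow ⟨k, by ring⟩
    have e2 : (-1 : ℝ) ^ (k + 1 + (k + 1)) = 1 := Even.neg_one_pow ⟨k + 1, by ring⟩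
    simp [e1, e2]
    ring
  · intro p _
    have := hA (k + 1) p (by have := p.2; omega)
    simp [this]

/-! ### Determinant ratios, elimination pivots and the explicit recursions -/

section Pivot

variable {n m : ℕ} {lam mu : ℕ → ℝ}

/-- Entries of `I - B^k`. -/
noncomputable def tridiagEntry (lam mu : ℕ → ℝ) (p q : ℕ) : ℝ :=
  if q = p then 1 else if q = p + 1 then -(lam (p + 1) / (lam p + mu (p + 1)))
    else if q + 1 = p then -(mu p / (lam p + mu (p + 1))) else 0

theorem one_sub_tridiag (k : ℕ) : 1 - tridiag lam mu 0 k
    = Matrix.of fun p q : Fin k => tridiagEntry lam mu p q := by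
  ext p q
  simp only [tridiag, tridiagEntry, Matrix.sub_apply, Matrix.of_apply, Matrix.one_apply,
    Fin.ext_iff, zero_add]
  split_ifs <;> first | omega | simp

theorem det_one_sub_tridiag_succ (k : ℕ) : (1 - tridiag lam mu 0 (k + 2)).det =
    (1 - tridiag lam mu 0 (k + 1)).det - mu (k + 1) / (lam (k + 1) + mu (k + 2)) *
      (lam (k + 1) / (lam k + mu (k + 1))) * (1 - tridiag lam mu 0 k).det := by
  simp only [one_sub_tridiag]
  rw [det_tridiagonal_succ]
  · simp (disch := omega) only [tridiagEntry, if_neg, ↓reduceIte]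
    ring
  · intro p q h
    simp (disch := omega) only [tridiagEntry, if_neg]

theorem QueueRates.triPivot_lam_pos (Q : QueueRates n lam mu) (hm : m ≤ n) :
    0 < triPivot 0 mu lam m := by
  rw [← triPivot_thrRate (le_refl m)]
  exact (Q.triRates hm).triPivot_pos le_rfl hm

/-- The matrix `I - B^k` is the system of the open gate with row `m` divided by `lam m + mu (m +
1)`, so ratios of leading minors are the pivots divided by this factor. Positivity is carried along
to make the division by minors legitimate. -/
theorem QueueRates.det_mul (Q : QueueRates n lam mu) (hm : m + 1 ≤ n) :
    0 < (1 - tridiag lam mu 0 m).det ∧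
    (1 - tridiag lam mu 0 (m + 1)).det * (lam m + mu (m + 1)) =
      triPivot 0 mu lam (m + 1) * (1 - tridiag lam mu 0 m).det := by
  induction m with
  | zero => simp [one_sub_tridiag, tridiagEntry, triPivot, Q.mu_zero, add_comm]
  | succ k ih =>
    obtain ⟨h1, h2⟩ := ih (by omega)
    have hE := Q.triPivot_lam_pos (show k + 1 ≤ n by omega)
    have e1 : 0 < lam k + mu (k + 1) :=
      add_pos (Q.lam_pos k (by omega)) (Q.mu_pos (k + 1) (by omega) (by omega))
    have e2 : 0 < lam (k + 1) + mu (k + 2) :=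
      add_pos (Q.lam_pos (k + 1) (by omega)) (Q.mu_pos (k + 2) (by omega) (by omega))
    refine ⟨pos_of_mul_pos_left (h2 ▸ mul_pos hE h1) e1.le, ?_⟩
    have hdef : triPivot 0 mu lam (k + 2) = 0 + mu (k + 2) + lam (k + 1)
      - mu (k + 1) * lam (k + 1) / triPivot 0 mu lam (k + 1) := rfl
    have h3 : (1 - tridiag lam mu 0 k).det
        = (1 - tridiag lam mu 0 (k + 1)).det * (lam k + mu (k + 1))
          / triPivot 0 mu lam (k + 1) := by
      rw [eq_div_iff hE.ne', h2]; ring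
    rw [det_one_sub_tridiag_succ, hdef, h3]
    field_simp
    ring

theorem QueueRates.aCoeff_mul (Q : QueueRates n lam mu) (hm : m + 1 ≤ n) :
    aCoeff lam mu 0 (m + 1) * (lam m + mu (m + 1)) = triPivot 0 mu lam (m + 1) := by
  obtain ⟨h1, h2⟩ := Q.det_mul hm
  rw [aCoeff, Nat.add_sub_cancel, div_mul_eq_mul_div, h2, mul_div_cancel_right₀ _ h1.ne']

theorem QueueRates.pivotWorkload_eq (Q : QueueRates n lam mu) {j : ℕ} (hj : j + 1 ≤ n) :
    pivotWorkload lam mu 0 j = lam j * triForward 0 mu lam (bdiff (drift lam mu)) (j + 1) := by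
  induction j with
  | zero => simp [pivotWorkload, triForward, triPivot, Q.mu_zero, add_comm]
  | succ k ih =>
    have e2 : 0 < lam (k + 1) + mu (k + 2) :=
      add_pos (Q.lam_pos (k + 1) (by omega)) (Q.mu_pos (k + 2) (by omega) (by omega))
    have h1 := (Q.lam_pos k (by omega)).ne'
    have h2 := (Q.mu_pos (k + 1) (by omega) (by omega)).ne'
    have h3 := Q.triPivot_lam_pos (show k + 2 ≤ n by omega)
    have hT : triForward 0 mu lam (bdiff (drift lam mu)) (k + 1 + 1) = (bdiff (drift lam mu) (k + 2)
        + mu (k + 1) * triForward 0 mu lam (bdiff (drift lam mu)) (k + 1)) / triPivot 0 mu lam (k + 1 + 1) := rfl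
    rw [pivotWorkload, ih (by omega), hT, ← Q.aCoeff_mul hj, rho]
    rw [← Q.aCoeff_mul hj] at h3
    have h4 := (pos_of_mul_pos_left h3 e2.le).ne'
    have h5 := e2.ne'
    simp only [zero_add]
    field_simp

theorem QueueRates.pivotCost_eq (Q : QueueRates n lam mu) {h : ℕ → ℝ} {j : ℕ} (hj : j + 1 ≤ n) :
    pivotCost lam mu h 0 j = lam j * triForward 0 mu lam (bdiff h) (j + 1) := by
  induction j with
  | zero => simp [pivotCost, triForward, triPivot, Q.mu_zero, add_comm]; ring
  | succ k ih =>
    have e2 : 0 < lam (k + 1) + mu (k + 2) :=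
      add_pos (Q.lam_pos (k + 1) (by omega)) (Q.mu_pos (k + 2) (by omega) (by omega))
    have h1 := (Q.lam_pos k (by omega)).ne'
    have h2 := (Q.mu_pos (k + 1) (by omega) (by omega)).ne'
    have h3 := Q.triPivot_lam_pos (show k + 2 ≤ n by omega)
    have hT : triForward 0 mu lam (bdiff h) (k + 1 + 1) = (bdiff h (k + 2)
        + mu (k + 1) * triForward 0 mu lam (bdiff h) (k + 1)) / triPivot 0 mu lam (k + 1 + 1) := rfl
    rw [pivotCost, ih (by omega), hT, ← Q.aCoeff_mul hj, rho]
    rw [← Q.aCoeff_mul hj] at h3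
    have h4 := (pos_of_mul_pos_left h3 e2.le).ne'
    have h5 := e2.ne'
    simp only [zero_add]
    field_simp

/-- The term `ω_k / ρ_k` equals `mu (k + 1)` times the forward pass at `k + 1`; after this
substitution the stated recursion is `QueueRates.thrIndex_mul` solved for the increment of the
index. -/
theorem QueueRates.indexRec_eq (Q : QueueRates n lam mu) {h : ℕ → ℝ}
    (R : RegularRhs n (bdiff (drift lam mu)) (bdiff h)) {j : ℕ} (hj : j + 1 ≤ n) :
    indexRec lam mu h 0 j = thrIndex n lam mu (bdiff (drift lam mu)) (bdiff h) j := by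
  induction j with
  | zero =>
    have h1 := Q.thrIndex_mul R hj
    rw [Q.mu_zero] at h1
    rw [indexRec, div_eq_iff (by simpa using R.drift_pos.ne')]
    linear_combination -h1
  | succ k ih =>
    have h1 := Q.thrIndex_mul R hj
    rw [Q.triForward_eq_thrIndex_mul R (by omega)] at h1
    have hl := (Q.lam_pos k (by omega)).ne'
    have hm := Q.mu_pos (k + 1) (by omega) (by omega)
    have hZ := Q.triForward_lam_pos R (show 1 ≤ k + 1 by omega) (by omega)
    have hd := R.drift_nonneg (show 1 ≤ k + 2 by omega) hj
    have hq : pivotWorkload lam mu 0 k / rho lam mu k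
        = mu (k + 1) * triForward 0 mu lam (bdiff (drift lam mu)) (k + 1) := by
      rw [Q.pivotWorkload_eq (by omega), rho]
      field_simp
    have hpos : 0 < bdiff (drift lam mu) (k + 2)
        + mu (k + 1) * triForward 0 mu lam (bdiff (drift lam mu)) (k + 1) :=
      add_pos_of_nonneg_of_pos hd (mul_pos hm hZ)
    rw [indexRec, hq, ih (by omega), zero_add]
    rw [← eq_sub_iff_add_eq', div_eq_iff hpos.ne']
    linear_combination -h1

end Pivot

/-! ### Generators and Cesàro averages of the transition function -/

/-- A function on `{0, …, n}` as a sequence. -/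
def toSeq (n : ℕ) (f : Fin (n + 1) → ℝ) (i : ℕ) : ℝ := f (Fin.ofNat (n + 1) i)

@[simp]
theorem toSeq_val {n : ℕ} (f : Fin (n + 1) → ℝ) (i : Fin (n + 1)) : toSeq n f i = f i := by
  simp [toSeq]

/-- Birth rates under the policy `u`, as a sequence. -/
noncomputable def effBirth (n : ℕ) (lam : ℕ → ℝ) (u : Fin (n + 1) → ℝ) (i : ℕ) : ℝ :=
  if i < n then lam i * (1 - toSeq n u i) else 0

theorem birthRate_eq {n : ℕ} {lam : ℕ → ℝ} (u : Fin (n + 1) → ℝ) (i : Fin (n + 1)) :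
    birthRate n lam u i = effBirth n lam u i := by
  simp [birthRate, effBirth]

theorem sum_fin_ite_eq {n : ℕ} (F : ℕ → ℝ) (k : ℕ) :
    ∑ j : Fin (n + 1), (if (j : ℕ) = k then F j else 0) = if k ≤ n then F k else 0 := by
  rw [Fin.sum_univ_eq_sum_range (fun j => if j = k then F j else 0) (n + 1),
    Finset.sum_ite_eq' (Finset.range (n + 1)) k F]
  simp

/-- Both boundary terms are fictitious: `mu 0 = 0` covers the truncated `i - 1` at `i = 0`, and the
birth rate in state `n` is zero, so `F (n + 1)` never matters. -/
theorem generator_mulVec {n : ℕ} {lam mu : ℕ → ℝ} (hmu0 : mu 0 = 0) (u : Fin (n + 1) → ℝ)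
    (F : ℕ → ℝ) (i : Fin (n + 1)) :
    (generator n lam mu u *ᵥ fun j => F j) i =
      effBirth n lam u i * (F (i + 1) - F i) - mu i * (F i - F (i - 1)) := by
  have h : ∀ j : Fin (n + 1), generator n lam mu u i j * F j =
      (if (j : ℕ) = i + 1 then effBirth n lam u i * F j else 0)
      + (if (j : ℕ) = i - 1 then mu i * F j else 0)
      - (if (j : ℕ) = i then (effBirth n lam u i + mu i) * F j else 0) := by
    intro j
    simp only [generator, Matrix.of_apply, birthRate_eq, Fin.ext_iff]
    by_cases h0 : (i : ℕ) = 0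
    · rw [h0, hmu0]; split_ifs <;> first | contradiction | omega | ring
    · split_ifs <;> first | contradiction | omega | ring
  simp only [Matrix.mulVec, dotProduct, h, Finset.sum_sub_distrib, Finset.sum_add_distrib]
  rw [sum_fin_ite_eq (fun j => effBirth n lam u i * F j) (i + 1),
    sum_fin_ite_eq (fun j => mu i * F j) (i - 1),
    sum_fin_ite_eq (fun j => (effBirth n lam u i + mu i) * F j) i]
  have hi := i.2
  rw [if_pos (show (i : ℕ) - 1 ≤ n by omega), if_pos (show (i : ℕ) ≤ n by omega)]
  split_ifs with h1
  · ring
  · have : effBirth n lam u i = 0 := if_neg (by omega)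
    rw [this]; ring

/-- Stochastic matrices. -/
structure IsStoch {N : Type*} [Fintype N] (P : Matrix N N ℝ) : Prop where
  nonneg : ∀ i j, 0 ≤ P i j
  sum_row : ∀ i, ∑ j, P i j = 1

theorem generator_mulVec_one {n : ℕ} {lam mu : ℕ → ℝ} (hmu0 : mu 0 = 0) (u : Fin (n + 1) → ℝ) :
    generator n lam mu u *ᵥ 1 = 0 := by
  ext i
  rw [show (1 : Fin (n + 1) → ℝ) = fun _ => 1 from rfl,
    generator_mulVec (lam := lam) hmu0 u (fun _ => 1) i]
  simp

section Uniform

variable {n : ℕ} {lam mu : ℕ → ℝ} {Λ : ℝ} {u : Fin (n + 1) → ℝ}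

theorem QueueRates.rate_pos (Q : QueueRates n lam mu) (hΛ : ∀ i, i ≤ n → lam i + mu i ≤ Λ) :
    0 < Λ := by
  have h1 := hΛ 0 (by omega)
  have h2 := Q.lam_pos 0 (by omega)
  rw [Q.mu_zero] at h1
  linarith

theorem QueueRates.mu_nonneg (Q : QueueRates n lam mu) {i : ℕ} (hi : i ≤ n) : 0 ≤ mu i := by
  rcases Nat.eq_zero_or_pos i with rfl | h
  · exact Q.mu_zero.ge
  · exact (Q.mu_pos i h hi).le

theorem QueueRates.effBirth_nonneg (Q : QueueRates n lam mu) (hu : ∀ i, 0 ≤ u i ∧ u i ≤ 1)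
    (i : ℕ) : 0 ≤ effBirth n lam u i := by
  unfold effBirth
  split_ifs with h
  · exact mul_nonneg (Q.lam_pos i h.le).le (by unfold toSeq; linarith [(hu (Fin.ofNat (n + 1) i)).2])
  · exact le_rfl

theorem QueueRates.effBirth_le (Q : QueueRates n lam mu) (hu : ∀ i, 0 ≤ u i ∧ u i ≤ 1)
    {i : ℕ} (hi : i ≤ n) : effBirth n lam u i ≤ lam i := by
  unfold effBirth
  have := Q.lam_pos i hi
  have h0 := (hu (Fin.ofNat (n + 1) i)).1
  split_ifs with h
  · unfold toSeq; nlinarith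
  · exact this.le

theorem QueueRates.triRates_effBirth (Q : QueueRates n lam mu) (hu : ∀ i, 0 ≤ u i ∧ u i ≤ 1) :
    TriRates n mu (effBirth n lam u) where
  mu_zero := Q.mu_zero
  mu_pos := Q.mu_pos
  p_nonneg := Q.effBirth_nonneg hu
  p_last := if_neg (by omega)

theorem QueueRates.isStoch (Q : QueueRates n lam mu) (hΛ : ∀ i, i ≤ n → lam i + mu i ≤ Λ)
    (hu : ∀ i, 0 ≤ u i ∧ u i ≤ 1) : IsStoch (1 + Λ⁻¹ • generator n lam mu u) := by
  have hpos := Q.rate_pos hΛ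
  constructor
  · intro i j
    have hb := Q.effBirth_nonneg hu i
    have hm := Q.mu_nonneg (show (i : ℕ) ≤ n by have := i.2; omega)
    simp only [Matrix.add_apply, Matrix.smul_apply, generator, Matrix.of_apply, birthRate_eq,
      smul_eq_mul, Matrix.one_apply]
    have hinv := inv_pos.2 hpos
    by_cases hij : j = i
    · subst hij
      have h1 : effBirth n lam u j + mu j ≤ Λ := by
        have := Q.effBirth_le hu (show (j : ℕ) ≤ n by have := j.2; omega)
        linarith [hΛ j (by have := j.2; omega)]
      have h2 : Λ⁻¹ * (effBirth n lam u j + mu j) ≤ 1 := by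
        rw [inv_mul_le_iff₀ hpos, mul_one]; exact h1
      rw [if_pos rfl, if_neg (by omega), if_neg (by omega), if_pos rfl]
      linarith
    · rw [if_neg (fun h => hij h.symm), if_neg hij, zero_add]
      refine mul_nonneg hinv.le ?_
      split_ifs <;> first | exact hb | exact hm | exact le_rfl
  · intro i
    have h := congrFun (generator_mulVec_one (lam := lam) Q.mu_zero u) i
    simp only [Matrix.mulVec, dotProduct, Pi.one_apply, mul_one, Pi.zero_apply] at h
    simp only [Matrix.add_apply, Matrix.smul_apply, smul_eq_mul, Finset.sum_add_distrib,
      ← Finset.mul_sum, h, mul_zero, add_zero, Matrix.one_apply, Finset.sum_ite_eq,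
      Finset.mem_univ, if_true]

end Uniform

/-! ### Contractivity of the semigroup and time averages -/

section Exp

open scoped Matrix.Norms.Operator

variable {N : Type*} [Fintype N] [DecidableEq N]

theorem IsStoch.norm_le_one {P : Matrix N N ℝ} (hP : IsStoch P) : ‖P‖ ≤ 1 := by
  rw [Matrix.linfty_opNorm_def]
  have : (Finset.univ.sup fun i => ∑ j, ‖P i j‖₊) ≤ 1 := by
    refine Finset.sup_le fun i _ => ?_
    rw [← NNReal.coe_le_coe]
    push_cast
    simp only [Real.norm_eq_abs, abs_of_nonneg (hP.nonneg i _)]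
    exact (hP.sum_row i).le
  exact_mod_cast this

theorem norm_exp_le_of_norm_le_one [Nonempty N] {P : Matrix N N ℝ} (hP : ‖P‖ ≤ 1) {c : ℝ}
    (hc : 0 ≤ c) : ‖NormedSpace.exp (c • P)‖ ≤ Real.exp c := by
  have h1 := NormedSpace.exp_series_hasSum_exp' (𝕂 := ℝ) (c • P)
  have h2 := NormedSpace.exp_series_hasSum_exp' (𝕂 := ℝ) c
  rw [← Real.exp_eq_exp_ℝ] at h2
  refine (congrArg norm h1.tsum_eq.symm).trans_le (tsum_of_norm_bounded h2 fun k => ?_)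
  rw [norm_smul, smul_eq_mul, Real.norm_of_nonneg (by positivity), smul_pow, norm_smul, norm_pow,
    Real.norm_of_nonneg hc]
  have h3 : ‖P ^ k‖ ≤ 1 := (norm_pow_le P k).trans (pow_le_one₀ (norm_nonneg _) hP)
  exact mul_le_mul_of_nonneg_left (mul_le_of_le_one_right (by positivity) h3) (by positivity)

/-- Uniformization: `exp (t G)` is `exp (-t Λ)` times `exp (t Λ P)` with `P` stochastic, and `P` has
sup-operator norm at most `1`. -/
theorem norm_exp_generator_le [Nonempty N] {G : Matrix N N ℝ} {Λ : ℝ} (hΛ : 0 < Λ)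
    (hP : IsStoch (1 + Λ⁻¹ • G)) {t : ℝ} (ht : 0 ≤ t) : ‖NormedSpace.exp (t • G)‖ ≤ 1 := by
  set P := 1 + Λ⁻¹ • G with hPdef
  have h1 : t • G = algebraMap ℝ (Matrix N N ℝ) (-(t * Λ)) + (t * Λ) • P := by
    rw [hPdef, smul_add, smul_smul, mul_assoc, mul_inv_cancel₀ hΛ.ne', mul_one,
      Algebra.algebraMap_eq_smul_one]
    module
  have h2 : NormedSpace.exp (t • G)
      = Real.exp (-(t * Λ)) • NormedSpace.exp ((t * Λ) • P) := by
    have h3 : NormedSpace.exp (algebraMap ℝ (Matrix N N ℝ) (-(t * Λ)))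
        = algebraMap ℝ (Matrix N N ℝ) (NormedSpace.exp (-(t * Λ))) :=
      (NormedSpace.algebraMap_exp_comm _).symm
    rw [h1, Matrix.exp_add_of_commute _ _ (Algebra.commute_algebraMap_left _ _), h3,
      ← Real.exp_eq_exp_ℝ, Algebra.algebraMap_eq_smul_one,
      smul_mul_assoc, one_mul]
  rw [h2, norm_smul, Real.norm_of_nonneg (Real.exp_pos _).le]
  calc Real.exp (-(t * Λ)) * ‖NormedSpace.exp ((t * Λ) • P)‖
      ≤ Real.exp (-(t * Λ)) * Real.exp (t * Λ) :=
        mul_le_mul_of_nonneg_left (norm_exp_le_of_norm_le_one hP.norm_le_one (by positivity))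
          (Real.exp_pos _).le
    _ = 1 := by rw [← Real.exp_add]; simp

theorem hasDerivAt_exp_mulVec (G : Matrix N N ℝ) (g : N → ℝ) (i : N) (t : ℝ) :
    HasDerivAt (fun t : ℝ => (NormedSpace.exp (t • G) *ᵥ g) i)
      ((NormedSpace.exp (t • G) *ᵥ (G *ᵥ g)) i) t := by
  have h := hasDerivAt_exp_smul_const (𝕂 := ℝ) G t
  let l : Matrix N N ℝ →ₗ[ℝ] ℝ :=
    { toFun := fun M => (M *ᵥ g) i
      map_add' := fun A B => by simp [Matrix.add_mulVec]
      map_smul' := fun c A => by simp [Matrix.smul_mulVec] }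
  have h2 := (LinearMap.toContinuousLinearMap l).hasFDerivAt.comp_hasDerivAt t h
  rw [Matrix.mulVec_mulVec]
  exact h2

/-- If `f + G g` is constant, this constant is the Cesàro limit of `exp (t G) f`. -/
theorem tendsto_average_of_poisson {G : Matrix N N ℝ} {Λ : ℝ} (hΛ : 0 < Λ)
    (hP : IsStoch (1 + Λ⁻¹ • G)) {f g : N → ℝ} {x : ℝ} (hx : ∀ i, f i + (G *ᵥ g) i = x) (i : N) :
    Tendsto (fun T : ℝ => (1 / T) * ∫ t in (0 : ℝ)..T, (NormedSpace.exp (t • G) *ᵥ f) i)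
      atTop (𝓝 x) := by
  have : Nonempty N := ⟨i⟩
  have hG1 : G *ᵥ (1 : N → ℝ) = 0 := by
    ext j
    have h := hP.sum_row j
    simp only [Matrix.add_apply, Matrix.smul_apply, smul_eq_mul, Finset.sum_add_distrib,
      ← Finset.mul_sum, Matrix.one_apply, Finset.sum_ite_eq, Finset.mem_univ, if_true] at h
    have h2 : Λ⁻¹ * ∑ k, G j k = 0 := by linarith
    have h3 := (mul_eq_zero.1 h2).resolve_left (inv_pos.2 hΛ).ne'
    simpa [Matrix.mulVec, dotProduct] using h3
  have hone : ∀ t : ℝ, (NormedSpace.exp (t • G) *ᵥ (1 : N → ℝ)) i = 1 := by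
    intro t
    have hd : ∀ t : ℝ, HasDerivAt (fun t : ℝ => (NormedSpace.exp (t • G) *ᵥ (1 : N → ℝ)) i) 0 t := by
      intro t
      have := hasDerivAt_exp_mulVec G 1 i t
      rwa [hG1, Matrix.mulVec_zero] at this
    have := is_const_of_deriv_eq_zero (fun t => (hd t).differentiableAt) (fun t => (hd t).deriv) t 0
    simpa using this
  have hf : f = x • (1 : N → ℝ) - G *ᵥ g := by
    ext j
    simp only [Pi.sub_apply, Pi.smul_apply, Pi.one_apply, smul_eq_mul, mul_one]
    linarith [hx j]
  have hexp : ∀ t : ℝ, (NormedSpace.exp (t • G) *ᵥ f) i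
      = x - (NormedSpace.exp (t • G) *ᵥ (G *ᵥ g)) i := by
    intro t
    rw [hf, Matrix.mulVec_sub, Matrix.mulVec_smul, Pi.sub_apply, Pi.smul_apply, hone, smul_eq_mul,
      mul_one]
  have hcont : Continuous fun t : ℝ => (NormedSpace.exp (t • G) *ᵥ (G *ᵥ g)) i :=
    continuous_iff_continuousAt.2 fun t => (hasDerivAt_exp_mulVec G (G *ᵥ g) i t).continuousAt
  -- Since `f = x - G g` and `exp (t G) (G g)` is the derivative of `exp (t G) g`, the integral is
  -- `x T` up to a boundary term bounded by `2 ‖g‖`.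
  have hint : ∀ T : ℝ, ∫ t in (0 : ℝ)..T, (NormedSpace.exp (t • G) *ᵥ f) i
      = x * T - ((NormedSpace.exp (T • G) *ᵥ g) i - g i) := by
    intro T
    simp only [hexp]
    rw [intervalIntegral.integral_sub (by simp) (hcont.intervalIntegrable _ _),
      intervalIntegral.integral_eq_sub_of_hasDerivAt
        (fun t _ => hasDerivAt_exp_mulVec G g i t) (hcont.intervalIntegrable _ _)]
    simp [mul_comm]
  have hbound : ∀ T : ℝ, 0 < T → |(1 / T) * ((NormedSpace.exp (T • G) *ᵥ g) i - g i)|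
      ≤ (1 / T) * (2 * ‖g‖) := by
    intro T hT
    rw [abs_mul, abs_of_pos (by positivity : 0 < 1 / T)]
    refine mul_le_mul_of_nonneg_left ?_ (by positivity)
    have h1 : ‖(NormedSpace.exp (T • G) *ᵥ g) i‖ ≤ ‖g‖ :=
      (norm_le_pi_norm _ i).trans ((Matrix.linfty_opNorm_mulVec _ _).trans
        (mul_le_of_le_one_left (norm_nonneg _) (norm_exp_generator_le hΛ hP hT.le)))
    have h2 : ‖g i‖ ≤ ‖g‖ := norm_le_pi_norm _ i
    rw [Real.norm_eq_abs] at h1 h2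
    exact (abs_sub _ _).trans (by linarith)
  have hzero : Tendsto (fun T : ℝ => (1 / T) * ((NormedSpace.exp (T • G) *ᵥ g) i - g i))
      atTop (𝓝 0) := by
    refine squeeze_zero_norm' ((eventually_gt_atTop 0).mono fun T hT => hbound T hT) ?_
    have : Tendsto (fun T : ℝ => (1 / T) * (2 * ‖g‖)) atTop (𝓝 (0 * (2 * ‖g‖))) :=
      (tendsto_const_nhds.div_atTop tendsto_id).mul_const _
    simpa using this
  have hlim := (tendsto_const_nhds (x := x)).sub hzero
  rw [sub_zero] at hlim
  refine hlim.congr' ((eventually_gt_atTop 0).mono fun T hT => ?_)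
  simp only [hint]
  field_simp

end Exp

/-! ### Long-run averages through the Poisson equation -/

section Average

variable {n : ℕ} {lam mu : ℕ → ℝ} {u f : Fin (n + 1) → ℝ}

/-- The long-run average of `f` under the policy `u`. -/
noncomputable def longRun (n : ℕ) (lam mu : ℕ → ℝ) (u f : Fin (n + 1) → ℝ) : ℝ :=
  f 0 + effBirth n lam u 0 * triSol n 0 mu (effBirth n lam u) (bdiff (toSeq n f)) 1

/-- Function with prescribed differences. -/
noncomputable def cumul (y : ℕ → ℝ) (i : ℕ) : ℝ := ∑ k ∈ Finset.range i, y (k + 1)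

theorem cumul_succ_sub (y : ℕ → ℝ) (i : ℕ) : cumul y (i + 1) - cumul y i = y (i + 1) := by
  simp [cumul, Finset.sum_range_succ]

/-- At discount rate `0`, the tridiagonal system says precisely that `f i + p i * y (i + 1) - mu i *
y i` takes equal values at neighbouring states; its value at state `0` is the average. -/
theorem QueueRates.poisson (Q : QueueRates n lam mu) (hu : ∀ i, 0 ≤ u i ∧ u i ≤ 1)
    (i : Fin (n + 1)) :
    f i + (generator n lam mu u *ᵥ fun j =>
      cumul (triSol n 0 mu (effBirth n lam u) (bdiff (toSeq n f))) j) i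
        = longRun n lam mu u f := by
  set p := effBirth n lam u with hp
  set y := triSol n 0 mu p (bdiff (toSeq n f)) with hy
  have hsol : IsTriSol n 0 mu p (bdiff (toSeq n f)) y :=
    (Q.triRates_effBirth hu).isTriSol_triSol le_rfl
  have key : ∀ i ≤ n, toSeq n f i + (p i * y (i + 1) - mu i * y i) = f 0 + p 0 * y 1 := by
    intro i hi
    induction i with
    | zero => rw [Q.mu_zero]; simp [toSeq]
    | succ i ih =>
      have h1 := ih (by omega)
      have h2 := hsol i (by omega)
      simp only [bdiff, Nat.add_sub_cancel] at h2
      linear_combination h1 - h2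
  rw [generator_mulVec Q.mu_zero, cumul_succ_sub]
  have hi := key i (by have := i.2; omega)
  rw [toSeq_val] at hi
  have h3 : mu i * (cumul y i - cumul y (i - 1)) = mu i * y i := by
    rcases Nat.eq_zero_or_pos (i : ℕ) with h0 | h0
    · rw [h0, Q.mu_zero]; ring
    · obtain ⟨k, hk⟩ : ∃ k, (i : ℕ) = k + 1 := ⟨i - 1, by omega⟩
      rw [hk, Nat.add_sub_cancel, cumul_succ_sub]
  rw [h3, longRun]
  exact hi

theorem QueueRates.isLongRunAverage_of_poisson (Q : QueueRates n lam mu)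
    (hu : ∀ i, 0 ≤ u i ∧ u i ≤ 1) {g : Fin (n + 1) → ℝ} {x : ℝ}
    (h : ∀ i, f i + (generator n lam mu u *ᵥ g) i = x) : IsLongRunAverage n lam mu u f x := by
  intro i
  -- Any admissible uniformization rate serves here; the sum of all rates is one.
  have hΛ : ∀ i, i ≤ n → lam i + mu i ≤ ∑ k ∈ Finset.range (n + 1), (lam k + mu k) := by
    intro i hi
    refine Finset.single_le_sum (f := fun k => lam k + mu k) (fun k hk => ?_)
      (Finset.mem_range.2 (by omega))
    have hk := Finset.mem_range.1 hk
    exact add_nonneg (Q.lam_pos k (by omega)).le (Q.mu_nonneg (by omega))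
  exact tendsto_average_of_poisson (Q.rate_pos hΛ) (Q.isStoch hΛ hu) h i

theorem QueueRates.longRun_eq_of_poisson (Q : QueueRates n lam mu)
    (hu : ∀ i, 0 ≤ u i ∧ u i ≤ 1) {g : Fin (n + 1) → ℝ} {x : ℝ}
    (h : ∀ i, f i + (generator n lam mu u *ᵥ g) i = x) : longRun n lam mu u f = x :=
  tendsto_nhds_unique (Q.isLongRunAverage_of_poisson hu (Q.poisson hu) 0)
    (Q.isLongRunAverage_of_poisson hu h 0)

theorem QueueRates.isLongRunAverage (Q : QueueRates n lam mu) (hu : ∀ i, 0 ≤ u i ∧ u i ≤ 1)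
    (f : Fin (n + 1) → ℝ) : IsLongRunAverage n lam mu u f (longRun n lam mu u f) :=
  Q.isLongRunAverage_of_poisson hu (Q.poisson hu)

end Average

/-! ### Discounted values -/

section Discounted

open scoped Matrix.Norms.Operator

variable {N : Type*} [Fintype N] [DecidableEq N] {P : Matrix N N ℝ} {β : ℝ}

theorem IsStoch.abs_pow_mulVec_le (hP : IsStoch P) (r : N → ℝ) (t : ℕ) (i : N) :
    |((P ^ t) *ᵥ r) i| ≤ ‖r‖ := by
  have h : ‖(P ^ t) *ᵥ r‖ ≤ ‖r‖ := by
    induction t with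
    | zero => simp
    | succ t ih =>
      rw [pow_succ', ← Matrix.mulVec_mulVec]
      exact (Matrix.linfty_opNorm_mulVec _ _).trans
        ((mul_le_of_le_one_left (norm_nonneg _) hP.norm_le_one).trans ih)
  exact (norm_le_pi_norm ((P ^ t) *ᵥ r) i).trans h

theorem IsStoch.summable_discounted (hP : IsStoch P) (h0 : 0 ≤ β) (h1 : β < 1) (r : N → ℝ)
    (i : N) : Summable fun t : ℕ => β ^ t * ((P ^ t) *ᵥ r) i := by
  refine Summable.of_norm_bounded (g := fun t => β ^ t * ‖r‖)
    ((summable_geometric_of_lt_one h0 h1).mul_right _) fun t => ?_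
  rw [norm_mul, norm_pow, Real.norm_of_nonneg h0]
  exact mul_le_mul_of_nonneg_left (hP.abs_pow_mulVec_le r t i) (by positivity)

theorem IsStoch.discounted_eq (hP : IsStoch P) (h0 : 0 ≤ β) (h1 : β < 1) (r : N → ℝ) (i : N) :
    ∑' t : ℕ, β ^ t * ((P ^ t) *ᵥ r) i
      = r i + β * (P *ᵥ fun j => ∑' t : ℕ, β ^ t * ((P ^ t) *ᵥ r) j) i := by
  rw [(hP.summable_discounted h0 h1 r i).tsum_eq_zero_add]
  have h2 : HasSum (fun t : ℕ => β * ∑ j, P i j * (β ^ t * ((P ^ t) *ᵥ r) j))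
      (β * ∑ j, P i j * ∑' t : ℕ, β ^ t * ((P ^ t) *ᵥ r) j) :=
    (hasSum_sum fun j _ => ((hP.summable_discounted h0 h1 r j).hasSum.mul_left _)).mul_left _
  have h3 : ∀ t : ℕ, β ^ (t + 1) * ((P ^ (t + 1)) *ᵥ r) i
      = β * ∑ j, P i j * (β ^ t * ((P ^ t) *ᵥ r) j) := by
    intro t
    rw [pow_succ' P, ← Matrix.mulVec_mulVec]
    simp only [Matrix.mulVec, dotProduct, Finset.mul_sum]
    refine Finset.sum_congr rfl fun j _ => Finset.sum_congr rfl fun k _ => ?_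
    ring
  simp only [h3, h2.tsum_eq]
  rw [pow_zero, pow_zero, one_mul, Matrix.one_mulVec]
  rfl

theorem IsStoch.eq_zero_of_fixed (hP : IsStoch P) (h0 : 0 ≤ β) (h1 : β < 1) {v : N → ℝ}
    (hv : ∀ i, v i = β * (P *ᵥ v) i) : v = 0 := by
  have h : v = β • (P *ᵥ v) := by ext i; simpa using hv i
  have h2 : ‖v‖ ≤ β * ‖v‖ := by
    conv_lhs => rw [h]
    rw [norm_smul, Real.norm_of_nonneg h0]
    exact mul_le_mul_of_nonneg_left ((Matrix.linfty_opNorm_mulVec _ _).trans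
        (mul_le_of_le_one_left (norm_nonneg _) hP.norm_le_one)) h0
  have h3 : ‖v‖ = 0 := by nlinarith [norm_nonneg v]
  exact norm_eq_zero.1 h3

theorem IsStoch.isUnit_one_sub (hP : IsStoch P) (h0 : 0 ≤ β) (h1 : β < 1) :
    IsUnit (1 - β • P) := by
  rw [← Matrix.mulVec_injective_iff_isUnit]
  intro v w hvw
  have h2 : (1 - β • P) *ᵥ (v - w) = 0 := by rw [Matrix.mulVec_sub]; exact sub_eq_zero.2 hvw
  refine sub_eq_zero.1 (hP.eq_zero_of_fixed h0 h1 fun i => ?_)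
  have h3 := congrFun h2 i
  simp only [Matrix.sub_mulVec, Matrix.one_mulVec, Matrix.smul_mulVec, Pi.sub_apply,
    Pi.smul_apply, smul_eq_mul, Pi.zero_apply] at h3 ⊢
  linarith

/-- The visit at time `0` already counts `1`, and all later terms are nonnegative. -/
theorem IsStoch.one_le_discounted_single (hP : IsStoch P) (h0 : 0 ≤ β) (h1 : β < 1) (j : N) :
    1 ≤ ∑' t : ℕ, β ^ t * ((P ^ t) *ᵥ (Pi.single j 1 : N → ℝ)) j := by
  have hpow : ∀ t : ℕ, ∀ i k, 0 ≤ (P ^ t) i k := by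
    intro t
    induction t with
    | zero =>
      intro i k
      rw [pow_zero, Matrix.one_apply]
      split_ifs <;> norm_num
    | succ t ih =>
      intro i k
      rw [pow_succ, Matrix.mul_apply]
      exact Finset.sum_nonneg fun l _ => mul_nonneg (ih i l) (hP.nonneg l k)
  have h2 := (hP.summable_discounted h0 h1 (Pi.single j 1) j).le_tsum 0 fun t _ => by
    simpa using mul_nonneg (pow_nonneg h0 t) (hpow t j j)
  simpa using h2

end Discounted

/-! ### Comparison of policies that differ in one state -/

namespace BanditData

section

variable {N : Type*} [DecidableEq N] {B : BanditData N} {S : Finset N} {j : N}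

theorem activePolicy_mem (B : BanditData N) (S : Finset N) (i : N) :
    0 ≤ B.activePolicy S i ∧ B.activePolicy S i ≤ 1 := by
  unfold activePolicy
  split_ifs <;> norm_num

theorem activePolicy_sub (hj : j ∈ S) (hc : j ∈ B.ctrl) (i : N) :
    B.activePolicy S i - B.activePolicy (S.erase j) i = (Pi.single j 1 : N → ℝ) i := by
  by_cases hij : i = j
  · subst hij; simp [activePolicy, hj, hc]
  · simp [activePolicy, hij]

end

section

variable {N : Type*} [Fintype N] {B : BanditData N} {u : N → ℝ}

theorem IsRestlessBandit.isStoch_policyMatrix (hB : B.IsRestlessBandit)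
    (hu : ∀ i, 0 ≤ u i ∧ u i ≤ 1) : IsStoch (B.policyMatrix u) where
  nonneg i j := add_nonneg (mul_nonneg (hu i).1 (hB.nonneg1 i j))
    (mul_nonneg (sub_nonneg.2 (hu i).2) (hB.nonneg0 i j))
  sum_row i := by
    simp only [policyMatrix, Matrix.of_apply, Finset.sum_add_distrib, ← Finset.mul_sum, hB.sum0,
      hB.sum1]
    ring

theorem policyMatrix_mulVec (B : BanditData N) (u v : N → ℝ) (i : N) :
    (B.policyMatrix u *ᵥ v) i = ∑ j, B.P0 i j * v j + u i * ∑ j, (B.P1 i j - B.P0 i j) * v j := by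
  simp only [policyMatrix, Matrix.mulVec, dotProduct, Matrix.of_apply, Finset.mul_sum,
    ← Finset.sum_add_distrib]
  exact Finset.sum_congr rfl fun j _ => by ring

end

variable {N : Type*} [Fintype N] [DecidableEq N] {B : BanditData N} {β : ℝ} {u : N → ℝ}

theorem IsRestlessBandit.discounted_eq (hB : B.IsRestlessBandit) (hu : ∀ i, 0 ≤ u i ∧ u i ≤ 1)
    (h0 : 0 ≤ β) (h1 : β < 1) (r : N → ℝ) (i : N) :
    B.discounted β u r i = r i + β * (B.policyMatrix u *ᵥ B.discounted β u r) i :=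
  (hB.isStoch_policyMatrix hu).discounted_eq h0 h1 r i

theorem IsRestlessBandit.eq_discounted (hB : B.IsRestlessBandit) (hu : ∀ i, 0 ≤ u i ∧ u i ≤ 1)
    (h0 : 0 ≤ β) (h1 : β < 1) {r v : N → ℝ} (hv : ∀ i, v i = r i + β * (B.policyMatrix u *ᵥ v) i) :
    v = B.discounted β u r := by
  refine sub_eq_zero.1 ((hB.isStoch_policyMatrix hu).eq_zero_of_fixed h0 h1 fun i => ?_)
  rw [Matrix.mulVec_sub, Pi.sub_apply, Pi.sub_apply]
  linear_combination hv i - hB.discounted_eq hu h0 h1 r i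

/-- Discounted number of visits to `j` under the policy `u`. -/
noncomputable def visits (B : BanditData N) (β : ℝ) (u : N → ℝ) (j : N) : N → ℝ :=
  B.discounted β u (Pi.single j 1)

/-- If the value of `u` misses the evaluation equation of `u'` only at `j`, by `x`, then subtracting
`x` times the discounted visits to `j` under `u'` repairs it; uniqueness of the fixed point
concludes. -/
theorem IsRestlessBandit.discounted_sub (hB : B.IsRestlessBandit) {u' : N → ℝ}
    (hu : ∀ i, 0 ≤ u i ∧ u i ≤ 1) (hu' : ∀ i, 0 ≤ u' i ∧ u' i ≤ 1)
    (h0 : 0 ≤ β) (h1 : β < 1) {r r' : N → ℝ} {j : N} {x : ℝ}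
    (hx : ∀ i, r i - r' i + β * ((u i - u' i) * ∑ k, (B.P1 i k - B.P0 i k)
      * B.discounted β u r k) = x * (Pi.single j 1 : N → ℝ) i) (i : N) :
    B.discounted β u r i - B.discounted β u' r' i = x * B.visits β u' j i := by
  have h : B.discounted β u r - x • B.visits β u' j = B.discounted β u' r' := by
    refine hB.eq_discounted hu' h0 h1 fun i => ?_
    have e1 := hB.discounted_eq hu h0 h1 r i
    have e2 := hB.discounted_eq hu' h0 h1 (Pi.single j 1) i
    rw [policyMatrix_mulVec] at e1
    change B.visits β u' j i = _ + β * (B.policyMatrix u' *ᵥ B.visits β u' j) i at e2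
    rw [Matrix.mulVec_sub, Matrix.mulVec_smul, Pi.sub_apply, Pi.sub_apply, Pi.smul_apply,
      Pi.smul_apply, smul_eq_mul, smul_eq_mul, policyMatrix_mulVec B u' (B.discounted β u r)]
    linear_combination e1 - x * e2 + hx i
  have := congrFun h i
  simp only [Pi.sub_apply, Pi.smul_apply, smul_eq_mul] at this
  linarith

variable {S : Finset N} {j : N}

theorem IsRestlessBandit.activity_sub (hB : B.IsRestlessBandit) (h0 : 0 ≤ β) (h1 : β < 1)
    (hj : j ∈ S) (hc : j ∈ B.ctrl) (i : N) :
    B.activity β (B.activePolicy S) i - B.activity β (B.activePolicy (S.erase j)) i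
      = B.marginalWorkload β S j * B.visits β (B.activePolicy (S.erase j)) j i := by
  refine hB.discounted_sub (B.activePolicy_mem S) (B.activePolicy_mem _) h0 h1 (fun k => ?_) i
  rw [activePolicy_sub hj hc, ← mul_sub, activePolicy_sub hj hc]
  by_cases hk : k = j
  · subst hk
    simp [marginalWorkload, hc, activity]
  · simp [hk]

theorem IsRestlessBandit.cost_sub (hB : B.IsRestlessBandit) (h0 : 0 ≤ β) (h1 : β < 1)
    (hj : j ∈ S) (hc : j ∈ B.ctrl) (i : N) :
    B.cost β (B.activePolicy (S.erase j)) i - B.cost β (B.activePolicy S) i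
      = B.marginalCost β S j * B.visits β (B.activePolicy (S.erase j)) j i := by
  have h := hB.discounted_sub (B.activePolicy_mem S) (B.activePolicy_mem (S.erase j)) h0 h1
    (r := fun k => B.activePolicy S k * B.h1 k + (1 - B.activePolicy S k) * B.h0 k)
    (r' := fun k => B.activePolicy (S.erase j) k * B.h1 k
      + (1 - B.activePolicy (S.erase j) k) * B.h0 k)
    (x := -B.marginalCost β S j) (j := j) (fun k => ?_) i
  · unfold cost
    linarith
  · have e := activePolicy_sub hj hc k
    have hs : ∑ l, (B.P0 j l - B.P1 j l) * B.cost β (B.activePolicy S) l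
        = -∑ l, (B.P1 j l - B.P0 j l) * B.cost β (B.activePolicy S) l := by
      rw [← Finset.sum_neg_distrib]
      exact Finset.sum_congr rfl fun _ _ => by ring
    by_cases hk : k = j
    · subst hk
      rw [Pi.single_eq_same] at e ⊢
      rw [marginalCost, hs, e]
      change _ = -(_ + β * -∑ l, _ * B.discounted _ _ _ l) * 1
      linear_combination (B.h1 k - B.h0 k) * e
    · rw [Pi.single_eq_of_ne hk] at e ⊢
      rw [e]
      linear_combination (B.h1 k - B.h0 k) * e

theorem IsRestlessBandit.one_le_visits (hB : B.IsRestlessBandit) (hu : ∀ i, 0 ≤ u i ∧ u i ≤ 1)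
    (h0 : 0 ≤ β) (h1 : β < 1) : 1 ≤ B.visits β u j j :=
  (hB.isStoch_policyMatrix hu).one_le_discounted_single h0 h1 j

/-- Both differences carry the same factor, the discounted visits to `j` from `j`, which is at least
`1` and cancels. -/
theorem IsRestlessBandit.marginalRate_eq (hB : B.IsRestlessBandit) (h0 : 0 ≤ β) (h1 : β < 1)
    (hj : j ∈ S) (hc : j ∈ B.ctrl) :
    B.marginalRate β S j = B.marginalCost β S j / B.marginalWorkload β S j := by
  have h := hB.one_le_visits (B.activePolicy_mem (S.erase j)) h0 h1 (j := j)
  rw [marginalRate, hB.activity_sub h0 h1 hj hc, hB.cost_sub h0 h1 hj hc,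
    mul_div_mul_right _ _ (by linarith)]

/-- The normalized passive cost is the marginal cost of the policy that is always active. -/
theorem IsRestlessBandit.normalizedCost_eq (hB : B.IsRestlessBandit) (h0 : 0 ≤ β) (h1 : β < 1)
    (i : N) : B.normalizedCost β i = B.marginalCost β B.ctrl i := by
  set v := B.cost β (B.activePolicy B.ctrl) with hv
  have hact : B.activePolicy B.ctrl = fun _ => 1 := by
    ext i; simp [activePolicy, em]
  have hfix : ∀ i, v i = B.h1 i + β * (B.P1 *ᵥ v) i := by
    intro i
    have e := hB.discounted_eq (B.activePolicy_mem B.ctrl) h0 h1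
      (fun j => B.activePolicy B.ctrl j * B.h1 j + (1 - B.activePolicy B.ctrl j) * B.h0 j) i
    change v i = _ + β * (B.policyMatrix _ *ᵥ v) i at e
    have hP : B.policyMatrix (B.activePolicy B.ctrl) = B.P1 := by
      ext i j; simp [policyMatrix, hact]
    rw [hP, hact] at e
    simpa using e
  have hst : IsStoch B.P1 := ⟨hB.nonneg1, hB.sum1⟩
  have hunit := hst.isUnit_one_sub h0 h1
  have hsolve : (1 - β • B.P1)⁻¹ *ᵥ B.h1 = v := by
    have : B.h1 = (1 - β • B.P1) *ᵥ v := by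
      ext i
      simp only [Matrix.sub_mulVec, Matrix.one_mulVec, Matrix.smul_mulVec, Pi.sub_apply,
        Pi.smul_apply, smul_eq_mul]
      linarith [hfix i]
    rw [this, Matrix.mulVec_mulVec, Matrix.nonsing_inv_mul _ ((Matrix.isUnit_iff_isUnit_det _).1 hunit),
      Matrix.one_mulVec]
  rw [normalizedCost, ← Matrix.mulVec_mulVec, hsolve, marginalCost, ← hv]
  have e : ∑ j, (B.P0 i j - B.P1 i j) * v j = (B.P0 *ᵥ v) i - (B.P1 *ᵥ v) i := by
    simp [Matrix.mulVec, dotProduct, sub_mul]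
  rw [e]
  simp only [Matrix.sub_mulVec, Matrix.one_mulVec, Matrix.smul_mulVec, Pi.sub_apply,
    Pi.smul_apply, smul_eq_mul]
  linear_combination -(hfix i)

end BanditData

/-! ### Threshold sets and the index algorithms -/

section Threshold

variable {n : ℕ}

theorem mem_ctrl {i : Fin (n + 1)} : i ∈ ctrl n ↔ (i : ℕ) < n := by simp [ctrl]

theorem mem_thresholdSet {k : ℕ} {i : Fin (n + 1)} :
    i ∈ thresholdSet n k ↔ k ≤ (i : ℕ) + 1 ∧ (i : ℕ) < n := by simp [thresholdSet]

theorem ctrl_eq : ctrl n = thresholdSet n 1 := by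
  ext i; simp [mem_ctrl, mem_thresholdSet]

theorem card_ctrl : (ctrl n).card = n := by
  have : ctrl n = Finset.univ.map Fin.castSuccEmb := by
    ext i
    simp only [mem_ctrl, Finset.mem_map, Finset.mem_univ, true_and]
    constructor
    · intro h; exact ⟨⟨i, h⟩, rfl⟩
    · rintro ⟨j, rfl⟩; simp
  rw [this, Finset.card_map, Finset.card_univ, Fintype.card_fin]

theorem thresholdSet_erase {k : ℕ} {j : Fin (n + 1)} (hj : (j : ℕ) = k) :
    (thresholdSet n (k + 1)).erase j = thresholdSet n (k + 2) := by
  ext i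
  rw [Finset.mem_erase, mem_thresholdSet, mem_thresholdSet, Ne, Fin.ext_iff]
  omega

theorem thresholdSet_mem_family {k : ℕ} (hk : k ≤ n) :
    thresholdSet n (k + 1) ∈ thresholdFamily n := ⟨k + 1, by omega, by omega, rfl⟩

/-- If another element than the least one, `k`, is removed, `k` remains, and a threshold set that
contains `k` contains the removed element too. -/
theorem mem_innerBoundary_iff {k : ℕ} (hk : k < n) {j : Fin (n + 1)} :
    j ∈ innerBoundary (thresholdFamily n) (thresholdSet n (k + 1)) ↔ (j : ℕ) = k := by
  constructor
  · rintro ⟨hj, k', -, -, he⟩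
    by_contra hne
    rw [mem_thresholdSet] at hj
    have h1 : (⟨k, by omega⟩ : Fin (n + 1)) ∈ (thresholdSet n (k + 1)).erase j := by
      rw [Finset.mem_erase, mem_thresholdSet, Ne, Fin.ext_iff]
      exact ⟨fun h => hne h.symm, le_rfl, hk⟩
    rw [he, mem_thresholdSet] at h1
    have h2 : j ∈ (thresholdSet n (k + 1)).erase j := by
      rw [he, mem_thresholdSet]
      dsimp only at h1
      omega
    simp at h2
  · intro hj
    refine ⟨mem_thresholdSet.2 (by omega), ?_⟩
    rw [thresholdSet_erase hj]
    exact thresholdSet_mem_family hk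

theorem greedySet_eq {π : ℕ → Fin (n + 1)} {k : ℕ} (hπ : ∀ l < k, (π l : ℕ) = l) :
    greedySet (ctrl n) π k = thresholdSet n (k + 1) := by
  induction k with
  | zero => exact ctrl_eq
  | succ k ih =>
    rw [greedySet, ih fun l hl => hπ l (by omega), thresholdSet_erase (hπ k (by omega))]

theorem eq_of_mem_innerBoundary {π : ℕ → Fin (n + 1)}
    (h : ∀ k < n, π k ∈ innerBoundary (thresholdFamily n) (greedySet (ctrl n) π k)) :
    ∀ k < n, (π k : ℕ) = k := by
  intro k
  induction k using Nat.strong_induction_on with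
  | _ k ih =>
    intro hk
    have h1 := h k hk
    rw [greedySet_eq fun l hl => ih l hl (by omega)] at h1
    exact (mem_innerBoundary_iff hk).1 h1

/-- Marginal workloads `w` and costs `c`, relative to threshold sets, that satisfy the
conservation laws behind the index algorithms, with indices `ix`. -/
structure ThresholdLaws (n : ℕ) (w c : Finset (Fin (n + 1)) → Fin (n + 1) → ℝ)
    (hhat : Fin (n + 1) → ℝ) (ix : ℕ → ℝ) : Prop where
  input : ∀ j ∈ ctrl n, hhat j = c (thresholdSet n 1) j
  pos : ∀ m ≤ n, ∀ j ∈ ctrl n, 0 < w (thresholdSet n (m + 1)) j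
  step : ∀ m < n, ∀ j ∈ ctrl n, c (thresholdSet n (m + 2)) j - c (thresholdSet n (m + 1)) j
    = ix m * (w (thresholdSet n (m + 2)) j - w (thresholdSet n (m + 1)) j)
  index : ∀ j ∈ ctrl n, c (thresholdSet n (j + 1)) j = ix j * w (thresholdSet n (j + 1)) j
  mono : ∀ m, m + 1 < n → ix m ≤ ix (m + 1)

/-- Index of the preceding step, and `0` at the first step. -/
noncomputable def prevIndex (ix : ℕ → ℝ) (k : ℕ) : ℝ := if k = 0 then 0 else ix (k - 1)

variable {w c : Finset (Fin (n + 1)) → Fin (n + 1) → ℝ} {hhat : Fin (n + 1) → ℝ} {ix : ℕ → ℝ}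

/-- Summation by parts of the law `step` writes the marginal cost at the current set as the input
minus the accumulated dual terms, plus the previous index times the workload. The law `index`
evaluates the left side when it is the turn of `j`. -/
theorem ThresholdLaws.dual_value (H : ThresholdLaws n w c hhat ix) {j : Fin (n + 1)}
    (hj : j ∈ ctrl n) :
    (hhat j - ∑ l ∈ Finset.range j, (ix l - prevIndex ix l) * w (thresholdSet n (l + 1)) j)
      / w (thresholdSet n (j + 1)) j = ix j - prevIndex ix j := by
  have key : ∀ k ≤ n, c (thresholdSet n (k + 1)) j = hhat j
      - ∑ l ∈ Finset.range k, (ix l - prevIndex ix l) * w (thresholdSet n (l + 1)) j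
      + prevIndex ix k * w (thresholdSet n (k + 1)) j := by
    intro k hk
    induction k with
    | zero => simp [prevIndex, H.input j hj]
    | succ k ih =>
      have h1 := ih (by omega)
      have h2 := H.step k (by omega) j hj
      have h3 : prevIndex ix (k + 1) = ix k := by simp [prevIndex]
      rw [Finset.sum_range_succ, h3]
      linear_combination h1 + h2
  have hlt := mem_ctrl.1 hj
  rw [div_eq_iff (H.pos j hlt.le j hj).ne']
  linear_combination H.index j hj - key j hlt.le

theorem ThresholdLaws.index_of_AG1 (H : ThresholdLaws n w c hhat ix) {π : ℕ → Fin (n + 1)}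
    {ν : Fin (n + 1) → ℝ} (h : IsAG1Output (ctrl n) (thresholdFamily n) w hhat π ν) :
    ∀ k < n, ν (π k) = ix k := by
  obtain ⟨y, hy⟩ := h
  rw [card_ctrl] at hy
  have hπ := eq_of_mem_innerBoundary fun k hk => (hy k hk).1
  have hset : ∀ k ≤ n, greedySet (ctrl n) π k = thresholdSet n (k + 1) := fun k hk =>
    greedySet_eq fun l hl => hπ l (by omega)
  have hval : ∀ k < n, y k = ix k - prevIndex ix k := by
    intro k
    induction k using Nat.strong_induction_on with
    | _ k ih =>
      intro hk
      have hd := H.dual_value (j := π k) (mem_ctrl.2 (by rw [hπ k hk]; exact hk))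
      rw [hπ k hk] at hd
      rw [(hy k hk).2.1, hset k hk.le, ← hd]
      congr 2
      refine Finset.sum_congr rfl fun l hl => ?_
      have hl := Finset.mem_range.1 hl
      rw [ih l hl (by omega), hset l (by omega)]
  intro k hk
  induction k with
  | zero => rw [(hy 0 hk).2.2.2, if_pos rfl, hval 0 hk]; simp [prevIndex]
  | succ k ih =>
    rw [(hy _ hk).2.2.2, if_neg (by omega), hval _ hk, Nat.add_sub_cancel, ih (by omega)]
    simp [prevIndex]

/-- This is the law `step` divided by the new workload; it has the form of the rate update of the
second algorithm. -/
theorem ThresholdLaws.rate_succ (H : ThresholdLaws n w c hhat ix) {k : ℕ} (hk : k < n)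
    {j : Fin (n + 1)} (hj : j ∈ ctrl n) :
    c (thresholdSet n (k + 2)) j / w (thresholdSet n (k + 2)) j =
      c (thresholdSet n (k + 1)) j / w (thresholdSet n (k + 1)) j
        + (w (thresholdSet n (k + 1)) j / w (thresholdSet n (k + 2)) j - 1)
          * (c (thresholdSet n (k + 1)) j / w (thresholdSet n (k + 1)) j - ix k) := by
  have h1 := (H.pos k hk.le j hj).ne'
  have h2 : w (thresholdSet n (k + 2)) j ≠ 0 := (H.pos (k + 1) hk j hj).ne'
  rw [eq_add_of_sub_eq (H.step k hk j hj)]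
  field_simp
  ring

theorem ThresholdLaws.rate_self (H : ThresholdLaws n w c hhat ix) {j : Fin (n + 1)}
    (hj : j ∈ ctrl n) : c (thresholdSet n (j + 1)) j / w (thresholdSet n (j + 1)) j = ix j := by
  rw [div_eq_iff (H.pos j (mem_ctrl.1 hj).le j hj).ne', H.index j hj]

theorem ThresholdLaws.index_of_AG2 (H : ThresholdLaws n w c hhat ix) {π : ℕ → Fin (n + 1)}
    {ν : Fin (n + 1) → ℝ} (h : IsAG2Output (ctrl n) (thresholdFamily n) w hhat π ν) :
    ∀ k < n, ν (π k) = ix k := by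
  obtain ⟨r, hr0, hrs, hr⟩ := h
  rw [card_ctrl] at hr hrs
  have hπ := eq_of_mem_innerBoundary fun k hk => (hr k hk).1
  have hset : ∀ k ≤ n, greedySet (ctrl n) π k = thresholdSet n (k + 1) := fun k hk =>
    greedySet_eq fun l hl => hπ l (by omega)
  -- Rates are determined only on the current active set: the algorithm leaves `r k j` free once `j`
  -- has been removed.
  have hval : ∀ k < n, ∀ j ∈ thresholdSet n (k + 1),
      r k j = c (thresholdSet n (k + 1)) j / w (thresholdSet n (k + 1)) j := by
    intro k hk
    induction k with
    | zero =>
      intro j hj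
      have hj' : j ∈ ctrl n := ctrl_eq ▸ hj
      rw [hr0 j hj', H.input j hj', ctrl_eq]
    | succ k ih =>
      intro j hj
      have hj' := mem_thresholdSet.1 hj
      have hself := H.rate_self (j := π k) (mem_ctrl.2 (by rw [hπ k (by omega)]; omega))
      rw [hπ k (by omega)] at hself
      rw [hrs k hk j (by rw [hset (k + 1) hk.le]; exact hj), hset k (by omega),
        hset (k + 1) hk.le, ih (by omega) j (mem_thresholdSet.2 (by omega)),
        ih (by omega) (π k) (mem_thresholdSet.2 (by rw [hπ k (by omega)]; omega)), hself,
        ← H.rate_succ (by omega) (mem_ctrl.2 hj'.2)]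
  intro k hk
  have hself := H.rate_self (j := π k) (mem_ctrl.2 (by rw [hπ k hk]; exact hk))
  rw [hπ k hk] at hself
  rw [(hr k hk).2.2, hval k hk _ (mem_thresholdSet.2 (by rw [hπ k hk]; omega)), hself]

theorem val_ofNat {k : ℕ} (hk : k < n) : ((Fin.ofNat (n + 1) k : Fin (n + 1)) : ℕ) = k :=
  Nat.mod_eq_of_lt (by omega)

theorem greedySet_ofNat {k : ℕ} (hk : k ≤ n) :
    greedySet (ctrl n) (fun k => Fin.ofNat (n + 1) k) k = thresholdSet n (k + 1) :=
  greedySet_eq fun _ hl => val_ofNat (by omega)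

theorem ThresholdLaws.isAG1Output (H : ThresholdLaws n w c hhat ix) :
    IsAG1Output (ctrl n) (thresholdFamily n) w hhat (fun k => Fin.ofNat (n + 1) k)
      (fun j => ix j) := by
  refine ⟨fun k => ix k - prevIndex ix k, fun k hk => ?_⟩
  rw [card_ctrl] at hk
  have hin : ∀ j : Fin (n + 1), (j : ℕ) = k → ix k - prevIndex ix k =
      (hhat j - ∑ l ∈ Finset.range k, (ix l - prevIndex ix l)
        * w (greedySet (ctrl n) (fun k => Fin.ofNat (n + 1) k) l) j)
        / w (thresholdSet n (k + 1)) j := by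
    intro j hj
    have hd := H.dual_value (j := j) (mem_ctrl.2 (by omega))
    rw [hj] at hd
    rw [← hd]
    congr 2
    refine Finset.sum_congr rfl fun l hl => ?_
    rw [greedySet_ofNat (by have := Finset.mem_range.1 hl; omega)]
  rw [greedySet_ofNat hk.le]
  refine ⟨(mem_innerBoundary_iff hk).2 (val_ofNat hk), hin _ (val_ofNat hk),
    fun j hj => (hin j ((mem_innerBoundary_iff hk).1 hj)).le, ?_⟩
  dsimp only
  rw [val_ofNat hk, val_ofNat (show k - 1 < n by omega)]
  split_ifs with h0 <;> simp [prevIndex, h0]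

theorem ThresholdLaws.isAG2Output (H : ThresholdLaws n w c hhat ix) :
    IsAG2Output (ctrl n) (thresholdFamily n) w hhat (fun k => Fin.ofNat (n + 1) k)
      (fun j => ix j) := by
  have hself : ∀ k < n, ∀ j : Fin (n + 1), (j : ℕ) = k →
      c (thresholdSet n (k + 1)) j / w (thresholdSet n (k + 1)) j = ix k := by
    intro k hk j hj
    have := H.rate_self (j := j) (mem_ctrl.2 (by omega))
    rwa [hj] at this
  refine ⟨fun k j => c (thresholdSet n (k + 1)) j / w (thresholdSet n (k + 1)) j, ?_, ?_, ?_⟩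
  · intro j hj
    rw [H.input j hj, ctrl_eq]
  · rw [card_ctrl]
    intro k hk j hj
    rw [greedySet_ofNat hk.le, mem_thresholdSet] at hj
    rw [greedySet_ofNat hk.le, greedySet_ofNat (by omega)]
    dsimp only
    rw [hself k (by omega) _ (val_ofNat (by omega))]
    exact H.rate_succ (by omega) (mem_ctrl.2 hj.2)
  · rw [card_ctrl]
    intro k hk
    rw [greedySet_ofNat hk.le]
    refine ⟨(mem_innerBoundary_iff hk).2 (val_ofNat hk), fun j hj => ?_, ?_⟩
    · dsimp only
      rw [hself k hk _ (val_ofNat hk), hself k hk j ((mem_innerBoundary_iff hk).1 hj)]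
    · dsimp only
      rw [hself k hk _ (val_ofNat hk), val_ofNat hk]

theorem ThresholdLaws.isPCLIndexable (H : ThresholdLaws n w c hhat ix) :
    IsPCLIndexable (ctrl n) (thresholdFamily n) w hhat where
  subset := by
    rintro S ⟨k, -, -, rfl⟩ i hi
    exact mem_ctrl.2 (mem_thresholdSet.1 hi).2
  empty_mem := by
    refine ⟨n + 1, by omega, le_rfl, ?_⟩
    ext i
    simp only [Finset.notMem_empty, mem_thresholdSet, false_iff]
    omega
  accessible := by
    rintro S ⟨k, h1, -, rfl⟩ ⟨i, hi⟩
    rw [mem_thresholdSet] at hi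
    obtain ⟨m, rfl⟩ : ∃ m, k = m + 1 := ⟨k - 1, by omega⟩
    exact ⟨Fin.ofNat (n + 1) m, (mem_innerBoundary_iff (by omega)).2 (val_ofNat (by omega))⟩
  augmentable := by
    rintro S ⟨k, h1, h2, rfl⟩ hne
    have hk : k ≠ 1 := fun h => hne (by rw [h, ctrl_eq])
    obtain ⟨m, rfl⟩ : ∃ m, k = m + 2 := ⟨k - 2, by omega⟩
    have hv : ((Fin.ofNat (n + 1) m : Fin (n + 1)) : ℕ) = m := val_ofNat (by omega)
    refine ⟨Fin.ofNat (n + 1) m, mem_ctrl.2 (by omega), fun h => ?_, ?_⟩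
    · rw [mem_thresholdSet] at h; omega
    · rw [← thresholdSet_erase hv, Finset.insert_erase (mem_thresholdSet.2 (by omega))]
      exact thresholdSet_mem_family (by omega)
  workload_pos := by
    rintro S ⟨k, h1, h2, rfl⟩ j hj
    obtain ⟨m, rfl⟩ : ∃ m, k = m + 1 := ⟨k - 1, by omega⟩
    exact H.pos m (by omega) j hj
  index_mono := by
    intro π ν h k hk
    rw [card_ctrl] at hk
    have hv : ∀ k < n, ν (π k) = ix k := h.elim H.index_of_AG1 H.index_of_AG2
    rw [hv k (by omega), hv (k + 1) hk]
    exact H.mono k hk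
  exists_output := ⟨_, _, H.isAG1Output, H.isAG2Output⟩

end Threshold

/-! ### The admission control bandit -/

section Model

variable {n : ℕ} {lam mu h : ℕ → ℝ} {Λ β : ℝ} {u : Fin (n + 1) → ℝ}

theorem toSeq_of_le {f : ℕ → ℝ} {i : ℕ} (hi : i ≤ n) : toSeq n (fun j => f j) i = f i := by
  simp [toSeq, Nat.mod_eq_of_lt (show i < n + 1 by omega)]

theorem effBirth_zero {i : ℕ} (hi : i < n) : effBirth n lam (fun _ => 0) i = lam i := by
  simp [effBirth, hi, toSeq]

theorem effBirth_one (i : ℕ) : effBirth n lam (fun _ => 1) i = 0 := by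
  simp [effBirth, toSeq]

theorem shutOn_mem (S : Finset (Fin (n + 1))) (i : Fin (n + 1)) :
    0 ≤ shutOn n S i ∧ shutOn n S i ≤ 1 := by
  unfold shutOn
  split_ifs <;> norm_num

theorem shutOn_last (S : Finset (Fin (n + 1))) : toSeq n (shutOn n S) n = 1 := by
  simp [toSeq, shutOn]

/-- The set `S_{m+1}` starts at state `m`, so it corresponds to threshold `m`. -/
theorem effBirth_thresholdSet {m : ℕ} (hm : m ≤ n) :
    effBirth n lam (shutOn n (thresholdSet n (m + 1))) = thrRate lam m := by
  ext i
  unfold effBirth thrRate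
  by_cases hi : i < n
  · have hv : ((Fin.ofNat (n + 1) i : Fin (n + 1)) : ℕ) = i := val_ofNat hi
    simp only [if_pos hi, toSeq, shutOn, mem_thresholdSet, hv]
    by_cases him : i < m
    · rw [if_pos him, if_neg (by omega)]; ring
    · rw [if_neg him, if_pos (by omega)]; ring
  · rw [if_neg hi, if_neg (by omega)]

theorem generator_eq (u : Fin (n + 1) → ℝ) (i j : Fin (n + 1)) :
    generator n lam mu u i j = u i * generator n lam mu (fun _ => 1) i j
      + (1 - u i) * generator n lam mu (fun _ => 0) i j := by
  simp only [generator, Matrix.of_apply, birthRate]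
  split_ifs <;> ring

theorem policyMatrix_bandit (u : Fin (n + 1) → ℝ) :
    (bandit n lam mu h 0 Λ).policyMatrix u = 1 + Λ⁻¹ • generator n lam mu u := by
  ext i j
  simp only [BanditData.policyMatrix, bandit, Matrix.of_apply, Matrix.add_apply,
    Matrix.smul_apply, smul_eq_mul]
  rw [generator_eq u i j]
  ring

theorem activePolicy_bandit (S : Finset (Fin (n + 1))) :
    (bandit n lam mu h 0 Λ).activePolicy S = shutOn n S := by
  ext i
  have hi := i.2
  have : i ∉ ctrl n ↔ (i : ℕ) = n := by rw [mem_ctrl]; omega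
  simp only [BanditData.activePolicy, shutOn]
  change (if i ∈ S ∨ i ∉ ctrl n then (1 : ℝ) else 0) = _
  simp only [this]

theorem QueueRates.isRestlessBandit (Q : QueueRates n lam mu)
    (hΛ : ∀ i, i ≤ n → lam i + mu i ≤ Λ) : (bandit n lam mu h 0 Λ).IsRestlessBandit := by
  have s0 := Q.isStoch hΛ (u := fun _ => 0) (fun _ => by norm_num)
  have s1 := Q.isStoch hΛ (u := fun _ => 1) (fun _ => by norm_num)
  refine ⟨s0.nonneg, s1.nonneg, s0.sum_row, s1.sum_row, fun i => ?_, fun i hi j => ?_,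
    fun _ _ => rfl⟩
  · have := Q.rate_pos hΛ
    have := Q.lam_pos i (by have := i.2; omega)
    simp only [bandit, zero_add]
    positivity
  · have hi' : ¬ (i : ℕ) < n := fun h => hi (mem_ctrl.2 h)
    simp only [bandit, Matrix.add_apply, Matrix.smul_apply, generator, Matrix.of_apply, birthRate,
      if_neg hi']

theorem sum_transition_sub (hmu0 : mu 0 = 0) (f : Fin (n + 1) → ℝ) (i : Fin (n + 1)) :
    ∑ j, ((bandit n lam mu h 0 Λ).P1 i j - (bandit n lam mu h 0 Λ).P0 i j) * f j =
      if (i : ℕ) < n then -(lam i / Λ) * (toSeq n f (i + 1) - toSeq n f i) else 0 := by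
  have hf : f = fun j : Fin (n + 1) => toSeq n f j := by ext j; simp
  have e1 := generator_mulVec (lam := lam) hmu0 (fun _ => 1) (toSeq n f) i
  have e0 := generator_mulVec (lam := lam) hmu0 (fun _ => 0) (toSeq n f) i
  rw [← hf] at e1 e0
  have e : ∑ j, ((bandit n lam mu h 0 Λ).P1 i j - (bandit n lam mu h 0 Λ).P0 i j) * f j
      = Λ⁻¹ * ((generator n lam mu (fun _ => 1) *ᵥ f) i
        - (generator n lam mu (fun _ => 0) *ᵥ f) i) := by
    simp only [Matrix.mulVec, dotProduct, ← Finset.sum_sub_distrib, Finset.mul_sum]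
    refine Finset.sum_congr rfl fun j _ => ?_
    simp only [bandit, Matrix.add_apply, Matrix.smul_apply, smul_eq_mul]
    ring
  rw [e, e1, e0, effBirth_one]
  split_ifs with hi
  · rw [effBirth_zero hi]; ring
  · have : effBirth n lam (fun _ => 0) i = 0 := if_neg hi
    rw [this]; ring

/-- The discount rate that corresponds to the discount factor `β`. -/
noncomputable def discountRate (Λ β : ℝ) : ℝ := Λ * (1 - β) / β

theorem tendsto_discountRate (Λ : ℝ) : Tendsto (discountRate Λ) (𝓝[<] 1) (𝓝 0) := by
  have h : ContinuousAt (discountRate Λ) 1 := by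
    unfold discountRate
    exact ContinuousAt.div (by fun_prop) continuousAt_id one_ne_zero
  have h2 := h.tendsto
  rw [show discountRate Λ 1 = 0 by simp [discountRate]] at h2
  exact h2.mono_left nhdsWithin_le_nhds

theorem discountRate_nonneg (hΛ : 0 < Λ) (h0 : 0 < β) (h1 : β < 1) : 0 ≤ discountRate Λ β :=
  div_nonneg (mul_nonneg hΛ.le (by linarith)) h0.le

theorem IsTriSol.congr_rhs {α : ℝ} {p r r' x : ℕ → ℝ} (hx : IsTriSol n α mu p r x)
    (hr : ∀ i < n, r (i + 1) = r' (i + 1)) : IsTriSol n α mu p r' x := fun i hi => by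
  rw [← hr i hi]; exact hx i hi

/-- The increments of the discounted values solve a tridiagonal system. -/
theorem QueueRates.isTriSol_discounted (Q : QueueRates n lam mu)
    (hΛ : ∀ i, i ≤ n → lam i + mu i ≤ Λ) (hu : ∀ i, 0 ≤ u i ∧ u i ≤ 1) (h0 : 0 < β) (h1 : β < 1)
    (r : Fin (n + 1) → ℝ) :
    IsTriSol n (discountRate Λ β) mu (effBirth n lam u) (fun i => Λ * bdiff (toSeq n r) i)
      (fun i => β * bdiff (toSeq n ((bandit n lam mu h 0 Λ).discounted β u r)) i) := by
  have hΛ0 := Q.rate_pos hΛ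
  set v := (bandit n lam mu h 0 Λ).discounted β u r with hv
  set V := toSeq n v with hV
  set p := effBirth n lam u with hp
  -- The evaluation equation multiplied by `Λ`, with `Λ (1 - β)` written as the discount rate times
  -- `β`. Working with `β V` gives the generator coefficient one, and the difference of neighbouring
  -- equations is the claimed system.
  have key : ∀ i ≤ n, discountRate Λ β * (β * V i)
      = Λ * toSeq n r i + β * (p i * (V (i + 1) - V i) - mu i * (V i - V (i - 1))) := by
    intro i hi
    have e := (Q.isRestlessBandit (h := h) hΛ).discounted_eq hu h0.le h1 r ⟨i, by omega⟩
    rw [policyMatrix_bandit, ← hv, Matrix.add_mulVec, Matrix.one_mulVec, Matrix.smul_mulVec,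
      Pi.add_apply, Pi.smul_apply] at e
    have e2 := generator_mulVec (lam := lam) Q.mu_zero u V ⟨i, by omega⟩
    rw [show (fun j : Fin (n + 1) => V j) = v by ext j; simp [hV]] at e2
    have hvi : v ⟨i, by omega⟩ = V i := (toSeq_val v ⟨i, by omega⟩).symm
    have hri : r ⟨i, by omega⟩ = toSeq n r i := (toSeq_val r ⟨i, by omega⟩).symm
    rw [e2, hvi, hri, smul_eq_mul] at e
    dsimp only at e
    rw [← hp] at e
    rw [discountRate]
    field_simp at e ⊢
    linear_combination e
  intro i hi
  have k1 := key i hi.le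
  have k2 := key (i + 1) hi
  have k3 : mu i * bdiff V i = mu i * (V i - V (i - 1)) := rfl
  simp only [bdiff, Nat.add_sub_cancel, Nat.add_succ_sub_one] at k2 ⊢
  linear_combination k2 - k1

/-- Solution at discount rate `α` of the tridiagonal system of the `S`-active policy. -/
noncomputable def setSol (n : ℕ) (lam mu : ℕ → ℝ) (α : ℝ) (S : Finset (Fin (n + 1)))
    (r : ℕ → ℝ) : ℕ → ℝ :=
  triSol n α mu (effBirth n lam (shutOn n S)) r

theorem thrSol_eq_setSol {m : ℕ} (hm : m ≤ n) {r : ℕ → ℝ} :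
    thrSol n lam mu m r = setSol n lam mu 0 (thresholdSet n (m + 1)) r := by
  rw [setSol, effBirth_thresholdSet hm, thrSol]

/-- If `y` is the increment of the value of rejections, then `1 - y` solves the system whose
right-hand side is given by the drift. -/
theorem IsTriSol.one_sub {α : ℝ} (hu : toSeq n u n = 1) {y : ℕ → ℝ}
    (hy : IsTriSol n α mu (effBirth n lam u) (bdiff fun i => lam i * toSeq n u i) y) :
    IsTriSol n α mu (effBirth n lam u) (fun i => α + bdiff (drift lam mu) i)
      (fun i => 1 - y i) := by
  intro i hi
  have h1 := hy i hi
  have e1 : effBirth n lam u i = lam i * (1 - toSeq n u i) := if_pos hi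
  have e2 : effBirth n lam u (i + 1) = lam (i + 1) * (1 - toSeq n u (i + 1)) := by
    rcases Nat.lt_or_ge (i + 1) n with h | h
    · exact if_pos h
    · have : i + 1 = n := by omega
      rw [this, hu, effBirth, if_neg (by omega)]; ring
  simp only [bdiff, drift, Nat.add_sub_cancel] at h1 ⊢
  rw [e1, e2] at h1 ⊢
  linear_combination -h1

theorem QueueRates.marginalWorkload_eq (Q : QueueRates n lam mu)
    (hΛ : ∀ i, i ≤ n → lam i + mu i ≤ Λ) (h0 : 0 < β) (h1 : β < 1) (S : Finset (Fin (n + 1)))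
    (i : Fin (n + 1)) :
    (bandit n lam mu h 0 Λ).marginalWorkload β S i = if (i : ℕ) < n then lam i / Λ *
      setSol n lam mu (discountRate Λ β) S
        (fun i => discountRate Λ β + bdiff (drift lam mu) i) (i + 1) else 0 := by
  have hΛ0 := Q.rate_pos hΛ
  rw [BanditData.marginalWorkload, sum_transition_sub Q.mu_zero, activePolicy_bandit]
  change (if i ∈ ctrl n then lam i / (0 + Λ) else 0) + _ = _
  simp only [mem_ctrl]
  split_ifs with hi
  · set y : ℕ → ℝ := fun i =>
      β * bdiff (toSeq n ((bandit n lam mu h 0 Λ).activity β (shutOn n S))) i with hy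
    have hsol : IsTriSol n (discountRate Λ β) mu (effBirth n lam (shutOn n S)) _ y :=
      Q.isTriSol_discounted hΛ (shutOn_mem S) h0 h1 _
    have hsol' := (hsol.congr_rhs (r' := bdiff fun i => lam i * toSeq n (shutOn n S) i)
      (fun k hk => by
        have a1 : toSeq n (fun j => (bandit n lam mu h 0 Λ).θ j * shutOn n S j) (k + 1)
            = lam (k + 1) / (0 + Λ) * toSeq n (shutOn n S) (k + 1) := by
          simp [toSeq, bandit, Nat.mod_eq_of_lt (show k + 1 < n + 1 by omega)]
        have a2 : toSeq n (fun j => (bandit n lam mu h 0 Λ).θ j * shutOn n S j) k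
            = lam k / (0 + Λ) * toSeq n (shutOn n S) k := by
          simp [toSeq, bandit, Nat.mod_eq_of_lt (show k < n + 1 by omega)]
        simp only [bdiff, Nat.add_sub_cancel]
        rw [a1, a2]
        field_simp
        ring)).one_sub (shutOn_last S)
    have e := (Q.triRates_effBirth (shutOn_mem S)).eq_triSol (discountRate_nonneg hΛ0 h0 h1) hsol'
      (show 1 ≤ (i : ℕ) + 1 by omega) (by omega)
    rw [setSol, ← e, hy]
    simp only [bdiff, Nat.add_sub_cancel]
    ring
  · ring

theorem QueueRates.marginalCost_eq (Q : QueueRates n lam mu)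
    (hΛ : ∀ i, i ≤ n → lam i + mu i ≤ Λ) (h0 : 0 < β) (h1 : β < 1) (S : Finset (Fin (n + 1)))
    (i : Fin (n + 1)) :
    (bandit n lam mu h 0 Λ).marginalCost β S i = if (i : ℕ) < n then lam i / Λ *
      setSol n lam mu (discountRate Λ β) S (bdiff h) (i + 1) else 0 := by
  have hΛ0 := Q.rate_pos hΛ
  have hs : ∀ f : Fin (n + 1) → ℝ,
      ∑ j, ((bandit n lam mu h 0 Λ).P0 i j - (bandit n lam mu h 0 Λ).P1 i j) * f j
      = -∑ j, ((bandit n lam mu h 0 Λ).P1 i j - (bandit n lam mu h 0 Λ).P0 i j) * f j := by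
    intro f
    rw [← Finset.sum_neg_distrib]
    exact Finset.sum_congr rfl fun _ _ => by ring
  rw [BanditData.marginalCost, hs, sum_transition_sub Q.mu_zero, activePolicy_bandit]
  change h i / (0 + Λ) - h i / (0 + Λ) + _ = _
  split_ifs with hi
  · set y : ℕ → ℝ := fun i =>
      β * bdiff (toSeq n ((bandit n lam mu h 0 Λ).cost β (shutOn n S))) i with hy
    have hsol : IsTriSol n (discountRate Λ β) mu (effBirth n lam (shutOn n S)) _ y :=
      Q.isTriSol_discounted hΛ (shutOn_mem S) h0 h1 _
    have hr : (fun j => shutOn n S j * (bandit n lam mu h 0 Λ).h1 j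
        + (1 - shutOn n S j) * (bandit n lam mu h 0 Λ).h0 j) = fun j : Fin (n + 1) => h j / Λ := by
      ext j; simp only [bandit]; ring
    rw [hr] at hsol
    have hsol' := hsol.congr_rhs (r' := bdiff h) fun k hk => by
      simp only [bdiff, Nat.add_sub_cancel]
      rw [toSeq_of_le (f := fun j => h j / Λ) (show k + 1 ≤ n by omega),
        toSeq_of_le (f := fun j => h j / Λ) hk.le]
      field_simp
    have e := (Q.triRates_effBirth (shutOn_mem S)).eq_triSol (discountRate_nonneg hΛ0 h0 h1) hsol'
      (show 1 ≤ (i : ℕ) + 1 by omega) (by omega)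
    rw [setSol, ← e, hy]
    simp only [bdiff, Nat.add_sub_cancel]
    ring
  · ring

/-- Average marginal quantity of the set `S`, for the right-hand side `r`. -/
noncomputable def avgMarginal (n : ℕ) (lam mu : ℕ → ℝ) (Λ : ℝ) (r : ℕ → ℝ)
    (S : Finset (Fin (n + 1))) (i : Fin (n + 1)) : ℝ :=
  if (i : ℕ) < n then lam i / Λ * setSol n lam mu 0 S r (i + 1) else 0

theorem eventually_discount : ∀ᶠ β in 𝓝[<] (1 : ℝ), 0 < β ∧ β < 1 := by
  filter_upwards [Ioo_mem_nhdsLT (show (0 : ℝ) < 1 by norm_num)] with β hβ using hβ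

theorem QueueRates.tendsto_marginalWorkload (Q : QueueRates n lam mu)
    (hΛ : ∀ i, i ≤ n → lam i + mu i ≤ Λ) (S : Finset (Fin (n + 1))) (i : Fin (n + 1)) :
    Tendsto (fun β => (bandit n lam mu h 0 Λ).marginalWorkload β S i) (𝓝[<] 1)
      (𝓝 (avgMarginal n lam mu Λ (bdiff (drift lam mu)) S i)) := by
  refine Tendsto.congr' (eventually_discount.mono fun β hβ =>
    (Q.marginalWorkload_eq hΛ hβ.1 hβ.2 S i).symm) ?_
  unfold avgMarginal
  split_ifs with hi
  · refine tendsto_const_nhds.mul ((Q.triRates_effBirth (shutOn_mem S)).tendsto_triSol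
      (tendsto_discountRate Λ) (fun k _ _ => ?_) hi)
    simpa using (tendsto_discountRate Λ).add_const (bdiff (drift lam mu) k)
  · exact tendsto_const_nhds

theorem QueueRates.tendsto_marginalCost (Q : QueueRates n lam mu)
    (hΛ : ∀ i, i ≤ n → lam i + mu i ≤ Λ) (S : Finset (Fin (n + 1))) (i : Fin (n + 1)) :
    Tendsto (fun β => (bandit n lam mu h 0 Λ).marginalCost β S i) (𝓝[<] 1)
      (𝓝 (avgMarginal n lam mu Λ (bdiff h) S i)) := by
  refine Tendsto.congr' (eventually_discount.mono fun β hβ =>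
    (Q.marginalCost_eq hΛ hβ.1 hβ.2 S i).symm) ?_
  unfold avgMarginal
  split_ifs with hi
  · exact tendsto_const_nhds.mul ((Q.triRates_effBirth (shutOn_mem S)).tendsto_triSol
      (R := fun _ => bdiff h) (tendsto_discountRate Λ) (fun k _ _ => tendsto_const_nhds) hi)
  · exact tendsto_const_nhds

theorem QueueRates.isAverageLimit (Q : QueueRates n lam mu)
    (hΛ : ∀ i, i ≤ n → lam i + mu i ≤ Λ) :
    (bandit n lam mu h 0 Λ).IsAverageLimit (thresholdFamily n)
      (avgMarginal n lam mu Λ (bdiff (drift lam mu))) (avgMarginal n lam mu Λ (bdiff h))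
      (avgMarginal n lam mu Λ (bdiff h) (ctrl n)) where
  workload S _ i := Q.tendsto_marginalWorkload hΛ S i
  cost S _ i := Q.tendsto_marginalCost hΛ S i
  input i := (Q.tendsto_marginalCost hΛ (ctrl n) i).congr' (eventually_discount.mono fun _ hβ =>
    ((Q.isRestlessBandit hΛ).normalizedCost_eq hβ.1.le hβ.2 i).symm)

/-! ### Long-run averages under neighbouring policies -/

/-- The undiscounted counterpart of `BanditData.IsRestlessBandit.discounted_sub`: the Poisson
solution for `(u, f)` plus `κ` times the one for `(u', e)` solves the Poisson equation for `(u',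
f')`. -/
theorem QueueRates.longRun_of_perturbation (Q : QueueRates n lam mu) {u' f f' e : Fin (n + 1) → ℝ}
    (hu : ∀ i, 0 ≤ u i ∧ u i ≤ 1) (hu' : ∀ i, 0 ≤ u' i ∧ u' i ≤ 1) {κ : ℝ}
    (hκ : ∀ i : Fin (n + 1), f' i - f i + (effBirth n lam u' i - effBirth n lam u i)
      * triSol n 0 mu (effBirth n lam u) (bdiff (toSeq n f)) (i + 1) = κ * e i) :
    longRun n lam mu u' f' = longRun n lam mu u f + κ * longRun n lam mu u' e := by
  set W := cumul (triSol n 0 mu (effBirth n lam u) (bdiff (toSeq n f))) with hW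
  set Z := cumul (triSol n 0 mu (effBirth n lam u') (bdiff (toSeq n e))) with hZ
  refine Q.longRun_eq_of_poisson hu'
    (g := (fun j : Fin (n + 1) => W j) + κ • fun j : Fin (n + 1) => Z j) fun i => ?_
  have e1 := Q.poisson (f := f) hu i
  have e2 := Q.poisson (f := e) hu' i
  have e3 := hκ i
  rw [← hW, generator_mulVec Q.mu_zero, hW, cumul_succ_sub, ← hW] at e1
  rw [← hZ] at e2
  rw [Matrix.mulVec_add, Matrix.mulVec_smul, Pi.add_apply, Pi.smul_apply, smul_eq_mul,
    generator_mulVec Q.mu_zero u' W, hW, cumul_succ_sub, ← hW]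
  linear_combination e1 + e3 + κ * e2

theorem effBirth_erase_sub {S : Finset (Fin (n + 1))} {j : Fin (n + 1)} (hj : j ∈ S)
    (hjn : (j : ℕ) < n) (i : Fin (n + 1)) :
    shutOn n (S.erase j) i - shutOn n S i = -(Pi.single j 1 : Fin (n + 1) → ℝ) i ∧
    effBirth n lam (shutOn n (S.erase j)) i - effBirth n lam (shutOn n S) i
      = lam j * (Pi.single j 1 : Fin (n + 1) → ℝ) i := by
  by_cases hij : i = j
  · subst hij
    have : ¬ (i : ℕ) = n := by omega
    simp [effBirth, shutOn, hj, hjn, this]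
  · simp [effBirth, shutOn, hij]

/-- Long-run frequency of the state `j`. -/
noncomputable def frequency (n : ℕ) (lam mu : ℕ → ℝ) (u : Fin (n + 1) → ℝ) (j : Fin (n + 1)) : ℝ :=
  longRun n lam mu u (Pi.single j 1)

theorem QueueRates.longRun_cost_erase (Q : QueueRates n lam mu) {S : Finset (Fin (n + 1))}
    {j : Fin (n + 1)} (hj : j ∈ S) (hjn : (j : ℕ) < n) :
    longRun n lam mu (shutOn n (S.erase j)) (fun i => h i)
      - longRun n lam mu (shutOn n S) (fun i => h i)
      = lam j * setSol n lam mu 0 S (bdiff h) (j + 1)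
        * frequency n lam mu (shutOn n (S.erase j)) j := by
  have hT := Q.triRates_effBirth (shutOn_mem S)
  have hsol : IsTriSol n 0 mu (effBirth n lam (shutOn n S)) (bdiff h)
      (triSol n 0 mu (effBirth n lam (shutOn n S)) (bdiff (toSeq n fun i => h i))) :=
    (hT.isTriSol_triSol le_rfl).congr_rhs fun k hk => by
      simp only [bdiff, Nat.add_sub_cancel]
      rw [toSeq_of_le (f := h) hk, toSeq_of_le (f := h) hk.le]
  rw [Q.longRun_of_perturbation (shutOn_mem S) (shutOn_mem (S.erase j))
    (f := fun i => h i) (e := Pi.single j 1)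
    (κ := lam j * setSol n lam mu 0 S (bdiff h) (j + 1)) fun i => ?_]
  · unfold frequency; ring
  · rw [(effBirth_erase_sub hj hjn i).2]
    by_cases hij : i = j
    · subst hij
      rw [hT.eq_triSol le_rfl hsol (by omega) (by omega)]
      unfold setSol; ring
    · rw [Pi.single_eq_of_ne hij]; ring

theorem QueueRates.one_sub_triSol_rejection (Q : QueueRates n lam mu) (hu : ∀ i, 0 ≤ u i ∧ u i ≤ 1)
    (hlast : toSeq n u n = 1) {i : ℕ} (h1 : 1 ≤ i) (hi : i ≤ n) :
    1 - triSol n 0 mu (effBirth n lam u) (bdiff (toSeq n fun i => lam i * u i)) i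
      = triSol n 0 mu (effBirth n lam u) (bdiff (drift lam mu)) i := by
  have hT := Q.triRates_effBirth hu
  have hsol : IsTriSol n 0 mu (effBirth n lam u) (bdiff fun i => lam i * toSeq n u i)
      (triSol n 0 mu (effBirth n lam u) (bdiff (toSeq n fun i => lam i * u i))) :=
    (hT.isTriSol_triSol le_rfl).congr_rhs fun k hk => by
      simp [bdiff, toSeq, Nat.mod_eq_of_lt (show k + 1 < n + 1 by omega),
        Nat.mod_eq_of_lt (show k < n + 1 by omega)]
  refine hT.eq_triSol le_rfl ((hsol.one_sub hlast).congr_rhs fun k _ => ?_) h1 hi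
  ring

theorem QueueRates.longRun_rejection_erase (Q : QueueRates n lam mu) {S : Finset (Fin (n + 1))}
    {j : Fin (n + 1)} (hj : j ∈ S) (hjn : (j : ℕ) < n) :
    longRun n lam mu (shutOn n S) (fun i => lam i * shutOn n S i)
      - longRun n lam mu (shutOn n (S.erase j)) (fun i => lam i * shutOn n (S.erase j) i)
      = lam j * setSol n lam mu 0 S (bdiff (drift lam mu)) (j + 1)
        * frequency n lam mu (shutOn n (S.erase j)) j := by
  rw [Q.longRun_of_perturbation (shutOn_mem S) (shutOn_mem (S.erase j))
    (f := fun i => lam i * shutOn n S i) (e := Pi.single j 1)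
    (κ := -(lam j * setSol n lam mu 0 S (bdiff (drift lam mu)) (j + 1))) fun i => ?_]
  · unfold frequency; ring
  · obtain ⟨e1, e2⟩ := effBirth_erase_sub (lam := lam) hj hjn i
    rw [e2]
    by_cases hij : i = j
    · subst hij
      rw [Pi.single_eq_same] at e1 ⊢
      rw [setSol, ← Q.one_sub_triSol_rejection (shutOn_mem S) (shutOn_last S) (by omega) (by omega)]
      linear_combination lam i * e1
    · rw [Pi.single_eq_of_ne hij] at e1 ⊢
      linear_combination lam i * e1

theorem QueueRates.longRun_rejection (Q : QueueRates n lam mu) (hn : 1 ≤ n)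
    (hu : ∀ i, 0 ≤ u i ∧ u i ≤ 1) (hlast : toSeq n u n = 1) :
    longRun n lam mu u (fun i => lam i * u i) = lam 0 - effBirth n lam u 0
      * triSol n 0 mu (effBirth n lam u) (bdiff (drift lam mu)) 1 := by
  rw [← Q.one_sub_triSol_rejection hu hlast le_rfl hn, longRun]
  have : effBirth n lam u 0 = lam 0 * (1 - u 0) := by
    simp [effBirth, toSeq, show 0 < n by omega]
  rw [this, Fin.val_zero]
  ring

/-- The rejection rate is `lam 0` minus the effective birth rate in `0` times the first unknown of
the drift system. Raising the threshold strictly increases this product: for `m = 0` the birth rate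
becomes positive, and for `m ≥ 1` the first unknown grows because `g` is positive below the
threshold. -/
theorem QueueRates.longRun_rejection_threshold_lt (Q : QueueRates n lam mu) {s : ℕ → ℝ}
    (R : RegularRhs n (bdiff (drift lam mu)) s) {m : ℕ} (hm : m + 1 ≤ n) :
    longRun n lam mu (shutOn n (thresholdSet n (m + 2)))
        (fun i => lam i * shutOn n (thresholdSet n (m + 2)) i)
      < longRun n lam mu (shutOn n (thresholdSet n (m + 1)))
        (fun i => lam i * shutOn n (thresholdSet n (m + 1)) i) := by
  rw [Q.longRun_rejection (by omega) (shutOn_mem _) (shutOn_last _),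
    Q.longRun_rejection (by omega) (shutOn_mem _) (shutOn_last _),
    effBirth_thresholdSet (show m ≤ n by omega), effBirth_thresholdSet hm]
  change lam 0 - thrRate lam (m + 1) 0 * thrSol n lam mu (m + 1) (bdiff (drift lam mu)) 1
    < lam 0 - thrRate lam m 0 * thrSol n lam mu m (bdiff (drift lam mu)) 1
  have h0 := Q.lam_pos 0 (by omega)
  rw [show thrRate lam (m + 1) 0 = lam 0 from if_pos (by omega)]
  rcases Nat.eq_zero_or_pos m with rfl | h1
  · rw [show thrRate lam 0 0 = 0 from if_neg (by omega)]
    have := mul_pos h0 (Q.thrSol_pos R hm le_rfl (show 1 ≤ n by omega))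
    linarith
  · rw [show thrRate lam m 0 = lam 0 from if_pos h1]
    have := mul_lt_mul_of_pos_left (Q.thrSol_one_lt R hm h1) h0
    linarith

theorem QueueRates.thresholdLaws (Q : QueueRates n lam mu) (hΛ : 0 < Λ)
    (R : RegularRhs n (bdiff (drift lam mu)) (bdiff h)) :
    ThresholdLaws n (avgMarginal n lam mu Λ (bdiff (drift lam mu)))
      (avgMarginal n lam mu Λ (bdiff h)) (avgMarginal n lam mu Λ (bdiff h) (ctrl n))
      (thrIndex n lam mu (bdiff (drift lam mu)) (bdiff h)) where
  input j _ := by rw [ctrl_eq]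
  pos m hm j hj := by
    have hj := mem_ctrl.1 hj
    rw [avgMarginal, if_pos hj, ← thrSol_eq_setSol hm]
    exact mul_pos (div_pos (Q.lam_pos j hj.le) hΛ) (Q.thrSol_pos R hm (by omega) hj)
  step m hm j hj := by
    have hj := mem_ctrl.1 hj
    simp only [avgMarginal, if_pos hj]
    rw [← thrSol_eq_setSol hm, ← thrSol_eq_setSol hm, ← thrSol_eq_setSol hm.le,
      ← thrSol_eq_setSol hm.le]
    linear_combination lam j / Λ * Q.thrSol_sub R hm (show 1 ≤ (j : ℕ) + 1 by omega) hj
  index j hj := by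
    have hj := mem_ctrl.1 hj
    simp only [avgMarginal, if_pos hj]
    rw [← thrSol_eq_setSol hj.le, ← thrSol_eq_setSol hj.le, thrIndex]
    have := (Q.thrSol_pos R hj.le (show 1 ≤ (j : ℕ) + 1 by omega) hj).ne'
    field_simp
  mono m hm := Q.thrIndex_mono R hm

end Model

/-! ### The corollary -/

theorem corollary7p1 (n : ℕ) (hn : 1 ≤ n) (lam mu h : ℕ → ℝ)
    (hlam : ∀ i, i ≤ n → 0 < lam i)
    (hmu0 : mu 0 = 0) (hmu : ∀ i, 1 ≤ i → i ≤ n → 0 < mu i)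
    (hd1 : 0 < bdiff (drift lam mu) 1)
    (hd : ∀ i, 1 ≤ i → i + 1 ≤ n →
      0 ≤ bdiff (drift lam mu) (i + 1) ∧
      bdiff (drift lam mu) (i + 1) ≤ bdiff (drift lam mu) i)
    (hh : ∀ i, 1 ≤ i → i + 1 ≤ n → bdiff h i ≤ bdiff h (i + 1) ∧ 0 ≤ bdiff h i) :
    -- `bbar u`, `vbar u`: long-run average rejection rate and holding cost rate under `u`
    ∃ bbar vbar : (Fin (n + 1) → ℝ) → ℝ,
      (∀ u, IsPolicy n u →
        IsAverageRejection n lam mu u (bbar u) ∧ IsAverageCost n lam mu h u (vbar u)) ∧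
      -- for every valid uniformization rate `Λ`
      ∀ Λ : ℝ, (∀ i, i ≤ n → lam i + mu i ≤ Λ) →
        (bandit n lam mu h 0 Λ).IsRestlessBandit ∧
        ∃ (w c : Finset (Fin (n + 1)) → Fin (n + 1) → ℝ) (hhat ν : Fin (n + 1) → ℝ),
          (bandit n lam mu h 0 Λ).IsAverageLimit (thresholdFamily n) w c hhat ∧
          -- PCL-indexability, and the index vector `ν`
          IsPCLIndexable (ctrl n) (thresholdFamily n) w hhat ∧
          IsAG1Output (ctrl n) (thresholdFamily n) w hhat (fun k => Fin.ofNat (n + 1) k) ν ∧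
          IsAG2Output (ctrl n) (thresholdFamily n) w hhat (fun k => Fin.ofNat (n + 1) k) ν ∧
          -- the recursions at discount rate `0`
          (∀ j ∈ ctrl n, ν j = indexRec lam mu h 0 j ∧
            Λ * w (thresholdSet n (j + 2)) j = pivotWorkload lam mu 0 j ∧
            Λ * c (thresholdSet n (j + 2)) j = pivotCost lam mu h 0 j) ∧
          -- the average marginal cost rate `c / w` of `j ∈ S_k` is the limit of the discounted
          -- quotients (whose denominators are eventually positive), and it is the quotient of the
          -- differences of the long-run averages whenever the latter do not both vanish
          (∀ k, 1 ≤ k → k ≤ n → ∀ j ∈ thresholdSet n k,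
            (∀ᶠ β in 𝓝[<] (1 : ℝ),
              (bandit n lam mu h 0 Λ).activity β
                  ((bandit n lam mu h 0 Λ).activePolicy ((thresholdSet n k).erase j)) j
                < (bandit n lam mu h 0 Λ).activity β
                  ((bandit n lam mu h 0 Λ).activePolicy (thresholdSet n k)) j) ∧
            Tendsto (fun β => (bandit n lam mu h 0 Λ).marginalRate β (thresholdSet n k) j)
              (𝓝[<] 1) (𝓝 (c (thresholdSet n k) j / w (thresholdSet n k) j)) ∧
            vbar (shutOn n ((thresholdSet n k).erase j)) - vbar (shutOn n (thresholdSet n k)) =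
              c (thresholdSet n k) j / w (thresholdSet n k) j *
                (bbar (shutOn n (thresholdSet n k))
                  - bbar (shutOn n ((thresholdSet n k).erase j)))) ∧
          -- the index is the largest average marginal cost rate
          (∀ j ∈ ctrl n, IsGreatest
            {r | ∃ k, 1 ≤ k ∧ k ≤ n ∧ j ∈ thresholdSet n k ∧
              r = c (thresholdSet n k) j / w (thresholdSet n k) j} (ν j)) ∧
          (∀ j ∈ ctrl n, IsGreatest
            {r | ∃ k, 1 ≤ k ∧ k ≤ n ∧ j ∈ thresholdSet n k ∧
              bbar (shutOn n (thresholdSet n k))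
                - bbar (shutOn n ((thresholdSet n k).erase j)) ≠ 0 ∧
              r = (vbar (shutOn n ((thresholdSet n k).erase j))
                    - vbar (shutOn n (thresholdSet n k))) /
                  (bbar (shutOn n (thresholdSet n k))
                    - bbar (shutOn n ((thresholdSet n k).erase j)))} (ν j)) := by
  have Q : QueueRates n lam mu := ⟨hlam, hmu0, hmu⟩
  have R : RegularRhs n (bdiff (drift lam mu)) (bdiff h) := ⟨hd1, hd, hh⟩
  refine ⟨fun u => longRun n lam mu u fun i => lam i * u i,
    fun u => longRun n lam mu u fun i => h i,
    fun u hu => ⟨Q.isLongRunAverage hu.1 _, Q.isLongRunAverage hu.1 _⟩, fun Λ hΛ => ?_⟩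
  have hΛ0 := Q.rate_pos hΛ
  have H := Q.thresholdLaws hΛ0 R
  have hB := Q.isRestlessBandit (h := h) hΛ
  have hrate : ∀ m ≤ n, ∀ j ∈ ctrl n,
      avgMarginal n lam mu Λ (bdiff h) (thresholdSet n (m + 1)) j /
        avgMarginal n lam mu Λ (bdiff (drift lam mu)) (thresholdSet n (m + 1)) j
      = thrRatio n lam mu (bdiff (drift lam mu)) (bdiff h) m j := by
    intro m hm j hj
    have hj := mem_ctrl.1 hj
    simp only [avgMarginal, if_pos hj]
    rw [← thrSol_eq_setSol hm, ← thrSol_eq_setSol hm,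
      mul_div_mul_left _ _ (div_pos (Q.lam_pos j hj.le) hΛ0).ne', thrRatio]
  have hle : ∀ k, 1 ≤ k → k ≤ n → ∀ j ∈ thresholdSet n k,
      avgMarginal n lam mu Λ (bdiff h) (thresholdSet n k) j /
        avgMarginal n lam mu Λ (bdiff (drift lam mu)) (thresholdSet n k) j
      ≤ thrIndex n lam mu (bdiff (drift lam mu)) (bdiff h) j := by
    intro k h1 h2 j hj
    obtain ⟨m, rfl⟩ : ∃ m, k = m + 1 := ⟨k - 1, by omega⟩
    have hj := mem_thresholdSet.1 hj
    rw [hrate m (by omega) j (mem_ctrl.2 hj.2)]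
    exact Q.thrRatio_le R hj.2 (by omega)
  have hquot : ∀ k, 1 ≤ k → k ≤ n → ∀ j ∈ thresholdSet n k,
      longRun n lam mu (shutOn n ((thresholdSet n k).erase j)) (fun i => h i)
        - longRun n lam mu (shutOn n (thresholdSet n k)) (fun i => h i)
      = avgMarginal n lam mu Λ (bdiff h) (thresholdSet n k) j /
          avgMarginal n lam mu Λ (bdiff (drift lam mu)) (thresholdSet n k) j *
        (longRun n lam mu (shutOn n (thresholdSet n k))
            (fun i => lam i * shutOn n (thresholdSet n k) i)
          - longRun n lam mu (shutOn n ((thresholdSet n k).erase j))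
            (fun i => lam i * shutOn n ((thresholdSet n k).erase j) i)) := by
    intro k h1 h2 j hj
    obtain ⟨m, rfl⟩ : ∃ m, k = m + 1 := ⟨k - 1, by omega⟩
    have hjn := (mem_thresholdSet.1 hj).2
    have hpos := (Q.thrSol_pos R (show m ≤ n by omega) (show 1 ≤ (j : ℕ) + 1 by omega) hjn).ne'
    rw [hrate m (by omega) j (mem_ctrl.2 hjn), Q.longRun_cost_erase hj hjn,
      Q.longRun_rejection_erase hj hjn, thrRatio, ← thrSol_eq_setSol (show m ≤ n by omega),
      ← thrSol_eq_setSol (show m ≤ n by omega)]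
    field_simp
  refine ⟨hB, _, _, _, fun j => thrIndex n lam mu (bdiff (drift lam mu)) (bdiff h) j,
    Q.isAverageLimit hΛ, H.isPCLIndexable, H.isAG1Output, H.isAG2Output, ?_, ?_, ?_, ?_⟩
  · intro j hj
    have hj := mem_ctrl.1 hj
    have key : ∀ r, Λ * avgMarginal n lam mu Λ r (thresholdSet n (j + 2)) j
        = lam j * triForward 0 mu lam r (j + 1) := by
      intro r
      rw [avgMarginal, if_pos hj, ← thrSol_eq_setSol (m := (j : ℕ) + 1) hj, Q.thrSol_self hj]
      field_simp
    exact ⟨(Q.indexRec_eq R hj).symm, (key _).trans (Q.pivotWorkload_eq hj).symm,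
      (key _).trans (Q.pivotCost_eq hj).symm⟩
  · intro k h1 h2 j hj
    obtain ⟨m, rfl⟩ : ∃ m, k = m + 1 := ⟨k - 1, by omega⟩
    have hc : j ∈ ctrl n := mem_ctrl.2 (mem_thresholdSet.1 hj).2
    have hpos := H.pos m (by omega) j hc
    have hw := Q.tendsto_marginalWorkload (h := h) hΛ (thresholdSet n (m + 1)) j
    refine ⟨?_, ?_, hquot _ h1 h2 j hj⟩
    · filter_upwards [eventually_discount, hw.eventually (lt_mem_nhds hpos)] with β hβ hwβ
      have hv := hB.one_le_visits (j := j)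
        (BanditData.activePolicy_mem (bandit n lam mu h 0 Λ) ((thresholdSet n (m + 1)).erase j)) hβ.1.le hβ.2
      rw [← sub_pos, hB.activity_sub hβ.1.le hβ.2 hj hc]
      exact mul_pos hwβ (by linarith)
    · refine ((Q.tendsto_marginalCost hΛ (thresholdSet n (m + 1)) j).div hw hpos.ne').congr'
        (eventually_discount.mono fun β hβ => ?_)
      exact (hB.marginalRate_eq hβ.1.le hβ.2 hj hc).symm
  · intro j hj
    have hjn := mem_ctrl.1 hj
    refine ⟨⟨j + 1, by omega, hjn, mem_thresholdSet.2 ⟨le_rfl, hjn⟩, (H.rate_self hj).symm⟩, ?_⟩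
    rintro _ ⟨k, h1, h2, hk, rfl⟩
    exact hle k h1 h2 j hk
  · intro j hj
    have hjn := mem_ctrl.1 hj
    refine ⟨⟨j + 1, by omega, hjn, mem_thresholdSet.2 ⟨le_rfl, hjn⟩, ?_⟩, ?_⟩
    · have hne : longRun n lam mu (shutOn n (thresholdSet n (j + 1)))
            (fun i => lam i * shutOn n (thresholdSet n (j + 1)) i)
          - longRun n lam mu (shutOn n ((thresholdSet n (j + 1)).erase j))
            (fun i => lam i * shutOn n ((thresholdSet n (j + 1)).erase j) i) ≠ 0 := by
        rw [thresholdSet_erase rfl]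
        exact (sub_pos.2 (Q.longRun_rejection_threshold_lt R hjn)).ne'
      refine ⟨hne, ?_⟩
      rw [eq_div_iff hne, hquot _ (by omega) hjn j (mem_thresholdSet.2 ⟨le_rfl, hjn⟩),
        H.rate_self hj]
    · rintro _ ⟨k, h1, h2, hk, hne, rfl⟩
      rw [hquot k h1 h2 j hk, mul_div_cancel_right₀ _ hne]
      exact hle k h1 h2 j hk
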